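/- **Setting.** Let $\Bbbk$ be a commutative ring, $A$ an associative unital $\Bbbk$-algebra and $\Omega_d^\bullet$ an exterior algebra over $A$: a differential graded $\Bbbk$-algebra with $\Omega_d^0=A$ in which $\Omega_d^n$ is spanned by the forms $a_0\,da_1\wedge\cdots\wedge da_n$. For a left $A$-module $E$ put $\Omega^n_dE=\Omega^n_d\otimes_A E$. - *Jets.* $J^1_dE=(A\otimes E)/N_dE$, where $N_dE$ is spanned by the elements $\sum_i a_i\otimes b_ie$ with $\sum_i a_ib_i=0$ and $\sum_i a_i\,db_i=0$; write $j^1(e)=[1\otimes e]$, $\pi^{1,0}[a\otimes e]=ae$ and $\iota^1\colon\Omega^1_dE\to J^1_dE$, $a\,db\otimes e\mapsto[a\otimes be]-[ab\otimes e]$. Let $(\Omega^1_d\ltimes\Omega^2_d)E=\Omega^1_dE\oplus\Omega^2_dE$ with the left action $a(\alpha+\beta)=a\alpha+da\wedge\alpha+a\beta$, and let $\widetilde D\colon J^1_dJ^1_dE\to(\Omega^1_d\ltimes\Omega^2_d)E$, $[a\otimes b]\otimes[c\otimes e]\mapsto a\,d(bc)\otimes e+da\wedge d(bc)\otimes e$.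 Put $J^0_dE=E$ and, for $n\ge 2$, $J^n_dE=\ker\big(J^1_dJ^{n-1}_dE\to J^1_dJ^1_dJ^{n-2}_dE\xrightarrow{\widetilde D}(\Omega^1_d\ltimes\Omega^2_d)J^{n-2}_dE\big)$. With the inclusions $l\colon J^{n}_dE\to J^1_dJ^{n-1}_dE$ one has the projections $\pi^{n,n-1}=\pi^{1,0}\circ l$ and the prolongations $j^n\colon E\to J^n_dE$, $l\circ j^{n}=j^1\circ j^{n-1}$, $j^0=\mathrm{id}$. - *Symmetric forms.* $S^0_dE=E$, $S^1_dE=\Omega^1_dE$ and, for $n\ge2$, $S^n_dE=\ker\big(\Omega^1_dS^{n-1}_dE\to\Omega^1_d\Omega^1_dS^{n-2}_dE\xrightarrow{\wedge}\Omega^2_dS^{n-2}_dE\big)$, with inclusions $\iota^{n}_{\wedge,E}\colon S^{n}_dE\to\Omega^1_dS^{n-1}_dE$ and $\iota^n\colon S^n_dE\to J^n_dE$ given by $\iota^0=\mathrm{id}$, $l\circ\iota^{n}=\iota^1\circ\Omega^1_d(\iota^{n-1})\circ\iota^{n}_{\wedge,E}$. - *Operators and symbols.* $\mathrm{Diff}^n_d(E,F)$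 is the set of maps $\Delta=\widetilde\Delta\circ j^n$ with $\widetilde\Delta\colon J^n_dE\to F$ left $A$-linear, $\mathrm{Diff}_d=\bigcup_n\mathrm{Diff}^n_d$, and $\mathrm{Symb}^n_d(E,F)=\mathrm{Diff}^n_d(E,F)/\mathrm{Diff}^{n-1}_d(E,F)$ with $\mathrm{Diff}^{-1}_d=0$. A *natural $n$-quantization* for $E$ is a $\Bbbk$-linear section $q^n_F$ of $\mathrm{Diff}^n_d(E,F)\to\mathrm{Symb}^n_d(E,F)$, natural in the left $A$-module $F$. A *natural full quantization* is the sum $q=\sum_nq^n\colon\bigoplus_n\mathrm{Symb}^n_d(E,-)\to\mathrm{Diff}_d(E,-)$ of natural $n$-quantizations, one for each $n\ge 0$. - *Connections.* A left connection on $E$ is an additive map $\nabla^E\colon E\to\Omega^1_dE$ with $\nabla^E(ae)=a\nabla^E e+da\otimes e$ (it is then $\Bbbk$-linear). A bimodule connection on $\Omega^1_d$ is a left connection $\nabla$ on $\Omega^1_d$ with a bimodule map $\sigma\colon\Omega^1_d\otimes_A\Omega^1_d\to\Omega^1_d\otimes_A\Omega^1_d$ such that $\nabla(\omega a)=\nabla(\omega)a+\sigma(\omega\otimes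 da)$. With a left connection $\nabla^F$ on $F$ it gives the left connection $\nabla^{\Omega^1_dF}(\omega\otimes f)=\nabla(\omega)\otimes f+(\sigma\otimes\mathrm{id}_F)(\omega\otimes\nabla^Ff)$ on $\Omega^1_dF$. **Corollary 5.18.** Let $E$ be a left $A$-module such that, for all $n$, $J^n_dE$ is elemental, i.e. generated as a left $A$-module by $j^n(E)$, and such that for all $n\ge1$ the $n$-jet sequence $S^n_dE\xrightarrow{\iota^n}J^n_dE\xrightarrow{\pi^{n,n-1}}J^{n-1}_dE\to0$ is exact. Let $\nabla^{\Omega^1_d}$ be a bimodule connection on $\Omega^1_d$ and $\nabla^E$ a left connection on $E$. 1. Let $s^{1,n}_E\colon\Omega^1_dS^n_dE\to S^{n+1}_dE$, $n\ge0$, be left $A$-linear retractions of $\iota^{n+1}_{\wedge,E}$. Then there are left connections $\nabla^{S^n_dE}$ on all $S^n_dE$ with $\nabla^{S^0_dE}=\nabla^E$ and $\nabla^{S^{n+1}_dE}=\Omega^1_d(s^{1,n}_E)\circ\nabla^{\Omega^1_dS^n_dE}\circ\iota^{n+1}_{\wedge,E}$, and there is a natural full quantization $q=\sum_n q^n$ for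 $E$ such that, for every left $A$-linear $\widetilde\Delta\colon J^n_dE\to F$, $$q^n_F\big([\widetilde\Delta\circ j^n]\big)=\widetilde\Delta\circ\iota^n\circ s^{1,n-1}_E\circ\nabla^{S^{n-1}_dE}\circ\cdots\circ s^{1,0}_E\circ\nabla^{E}.$$ 2. Let $s^{1,n}\colon\Omega^1_dS^n_dA\to S^{n+1}_dA$, $n\ge0$, be $A$-bimodule retractions of $\iota^{n+1}_{\wedge,A}$, and suppose that the canonical maps $S^n_dA\otimes_AE\to S^n_dE$ are surjective. Then for all $n$ there is exactly one left $A$-linear map $s^{1,n}\otimes_A\mathrm{id}_E\colon\Omega^1_dS^n_dE\to S^{n+1}_dE$ compatible with $s^{1,n}$ along the maps induced by $A\to E$, $a\mapsto ae$, for all $e\in E$; these maps are retractions of $\iota^{n+1}_{\wedge,E}$, and so, as in part 1, they induce left connections on all $S^n_dE$ and a natural full quantization for $E$. -/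

import Mathlib

open scoped TensorProduct DirectSum

universe w u

noncomputable section

namespace NCJet

/-! ### Tensor products over a noncommutative ring -/

section Tensor

variable {A : Type u} [Ring A]

/-- The relations `(m a) ⊗ e - m ⊗ (a e)`. -/
def balRel (A : Type u) [Ring A] (M E : Type u) [AddCommGroup M] [Module A M] [Module Aᵐᵒᵖ M]
    [SMulCommClass A Aᵐᵒᵖ M] [AddCommGroup E] [Module A E] : Submodule A (M ⊗[ℤ] E) :=
  Submodule.span A {x | ∃ (m : M) (a : A) (e : E),
    x = (MulOpposite.op a • m) ⊗ₜ[ℤ] e - m ⊗ₜ[ℤ] (a • e)}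

/-- The left `A`-module `M ⊗_A E`, for an `A`-bimodule `M` and a left `A`-module `E`. -/
def BT (A : Type u) [Ring A] (M E : Type u) [AddCommGroup M] [Module A M] [Module Aᵐᵒᵖ M]
    [SMulCommClass A Aᵐᵒᵖ M] [AddCommGroup E] [Module A E] : Type u :=
  (M ⊗[ℤ] E) ⧸ balRel A M E

namespace BT

variable {M E F G : Type u} [AddCommGroup M] [Module A M] [Module Aᵐᵒᵖ M]
  [SMulCommClass A Aᵐᵒᵖ M] [AddCommGroup E] [Module A E] [AddCommGroup F] [Module A F]
  [AddCommGroup G] [Module A G]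

instance : AddCommGroup (BT A M E) := Submodule.Quotient.addCommGroup (balRel A M E)
instance : Module A (BT A M E) := Submodule.Quotient.module (balRel A M E)

/-- The elementary tensor `m ⊗_A e`. -/
def tmul (A : Type u) [Ring A] {M E : Type u} [AddCommGroup M] [Module A M] [Module Aᵐᵒᵖ M]
    [SMulCommClass A Aᵐᵒᵖ M] [AddCommGroup E] [Module A E] (m : M) (e : E) : BT A M E :=
  (balRel A M E).mkQ (m ⊗ₜ[ℤ] e)

theorem add_tmul (m m' : M) (e : E) : tmul A (m + m') e = tmul A m e + tmul A m' e := by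
  simp only [tmul, TensorProduct.add_tmul]; exact map_add _ _ _

theorem tmul_add (m : M) (e e' : E) : tmul A m (e + e') = tmul A m e + tmul A m e' := by
  simp only [tmul, TensorProduct.tmul_add]; exact map_add _ _ _

theorem smul_tmul' (a : A) (m : M) (e : E) : a • tmul A m e = tmul A (a • m) e :=
  ((balRel A M E).mkQ.map_smul a (m ⊗ₜ[ℤ] e)).symm

theorem tmul_smul (m : M) (a : A) (e : E) :
    tmul A m (a • e) = tmul A (MulOpposite.op a • m) e :=
  ((Submodule.Quotient.eq (balRel A M E)).2 (Submodule.subset_span ⟨m, a, e, rfl⟩)).symm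

theorem zero_tmul (e : E) : tmul A (0 : M) e = 0 := by
  simp only [tmul, TensorProduct.zero_tmul]; exact map_zero (balRel A M E).mkQ

/-- `e ↦ (m ↦ m ⊗_A e)`. -/
def mk : E →+ (M →ₗ[A] BT A M E) where
  toFun e :=
    { toFun := fun m => tmul A m e
      map_add' := fun m m' => add_tmul m m' e
      map_smul' := fun a m => (smul_tmul' a m e).symm }
  map_zero' := by
    ext m
    simp only [tmul, TensorProduct.tmul_zero]; exact map_zero (balRel A M E).mkQ
  map_add' e e' := by ext m; exact tmul_add m e e'

@[simp] theorem mk_apply (e : E) (m : M) : mk (A := A) e m = tmul A m e := rfl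

theorem induction {p : BT A M E → Prop} (x : BT A M E) (h0 : p 0)
    (ht : ∀ m e, p (tmul A m e)) (ha : ∀ x y, p x → p y → p (x + y)) : p x := by
  obtain ⟨y, rfl⟩ := (balRel A M E).mkQ_surjective x
  induction y using TensorProduct.induction_on with
  | zero => rw [map_zero]; exact h0
  | tmul m e => exact ht m e
  | add x y hx hy => rw [map_add]; exact ha _ _ hx hy

/-- The additive map on `M ⊗_A E` induced by a balanced biadditive map. -/
def liftAdd {G : Type u} [AddCommGroup G] (f : M →+ E →+ G)
    (hf : ∀ (m : M) (a : A) (e : E), f (MulOpposite.op a • m) e = f m (a • e)) : BT A M E →+ G :=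
  QuotientAddGroup.lift (balRel A M E).toAddSubgroup
    (TensorProduct.liftAddHom f (fun r m e => by rw [map_zsmul, map_zsmul]; rfl))
    (by
      intro x hx
      have key : ∀ x ∈ balRel A M E, ∀ a : A, (TensorProduct.liftAddHom (R := ℤ) f
          (fun r m e => by rw [map_zsmul, map_zsmul]; rfl)) (a • x) = 0 := by
        intro x hx
        induction hx using Submodule.span_induction with
        | mem x h =>
          obtain ⟨m, b, e, rfl⟩ := h
          intro a
          rw [smul_sub, TensorProduct.smul_tmul', TensorProduct.smul_tmul', map_sub,
            TensorProduct.liftAddHom_tmul, TensorProduct.liftAddHom_tmul, smul_comm, hf, sub_self]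
        | zero => intro a; rw [smul_zero, map_zero]
        | add x y _ _ hx hy => intro a; rw [smul_add, map_add, hx, hy, add_zero]
        | smul r x _ hx => intro a; rw [smul_smul]; exact hx _
      have := key x hx 1
      rwa [one_smul] at this)

@[simp] theorem liftAdd_tmul {G : Type u} [AddCommGroup G] (f : M →+ E →+ G)
    (hf : ∀ (m : M) (a : A) (e : E), f (MulOpposite.op a • m) e = f m (a • e)) (m : M) (e : E) :
    liftAdd (A := A) f hf (tmul A m e) = f m e := rfl

/-- The left `A`-linear map on `M ⊗_A E` induced by a balanced biadditive map which is left
`A`-linear in the first variable. -/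
def lift (f : E →+ (M →ₗ[A] G)) (hf : ∀ (m : M) (a : A) (e : E), f e (MulOpposite.op a • m) = f (a • e) m) :
    BT A M E →ₗ[A] G where
  toFun := liftAdd (A := A) (AddMonoidHom.flip
    { toFun := fun e => (f e).toAddMonoidHom
      map_zero' := by ext m; simp
      map_add' := fun e e' => by ext m; simp }) hf
  map_add' := map_add _
  map_smul' a x := by
    induction x using BT.induction with
    | h0 => simp
    | ht m e => rw [smul_tmul']; exact (f e).map_smul a m
    | ha x y hx hy => simp only [smul_add, map_add, hx, hy]

@[simp] theorem lift_tmul (f : E →+ (M →ₗ[A] G))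
    (hf : ∀ (m : M) (a : A) (e : E), f e (MulOpposite.op a • m) = f (a • e) m) (m : M) (e : E) :
    lift f hf (tmul A m e) = f e m := rfl

/-- `id_M ⊗_A g`. -/
def map (M : Type u) [AddCommGroup M] [Module A M] [Module Aᵐᵒᵖ M] [SMulCommClass A Aᵐᵒᵖ M]
    (g : E →ₗ[A] F) : BT A M E →ₗ[A] BT A M F :=
  lift (mk.comp g.toAddMonoidHom) (fun m a e => by
    change tmul A _ (g e) = tmul A m (g (a • e))
    rw [map_smul, tmul_smul])

@[simp] theorem map_tmul (g : E →ₗ[A] F) (m : M) (e : E) :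
    map M g (tmul A m e) = tmul A m (g e) := rfl

end BT

/-- The `A`-linear map `A ⊗ E → G`, `a ⊗ e ↦ a f(e)`. -/
def extend {E G : Type u} [AddCommGroup E] [Module A E] [AddCommGroup G] [Module A G]
    (f : E →+ G) : A ⊗[ℤ] E →ₗ[A] G where
  toFun := TensorProduct.liftAddHom (R := ℤ)
    { toFun := fun a => (DistribSMul.toAddMonoidHom G a).comp f
      map_zero' := by ext; simp
      map_add' := fun a b => by ext; simp [add_smul] }
    (fun r a e => by
      change (r • a) • f e = a • f (r • e)
      rw [map_zsmul, smul_assoc, smul_comm])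
  map_add' := map_add _
  map_smul' a x := by
    induction x using TensorProduct.induction_on with
    | zero => simp
    | tmul b e => simp [TensorProduct.smul_tmul', mul_smul]
    | add x y hx hy => simp only [smul_add, map_add, hx, hy]

@[simp] theorem extend_tmul {E G : Type u} [AddCommGroup E] [Module A E] [AddCommGroup G]
    [Module A G] (f : E →+ G) (a : A) (e : E) : extend (A := A) f (a ⊗ₜ[ℤ] e) = a • f e := rfl

end Tensor

/-! ### Exterior algebras -/

/-- An exterior algebra `Ω^•` over the `k`-algebra `A`: a differential graded `k`-algebra with
`Ω^0 = A`, in which every `Ω^n` is spanned by the forms `a₀ da₁ ∧ ⋯ ∧ daₙ`. -/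
structure ExteriorCalculus (k : Type w) (A Ω : Type u) [CommRing k] [Ring A] [Algebra k A]
    [Ring Ω] [Algebra k Ω] where
  deg : ℕ → Submodule k Ω
  graded : GradedAlgebra deg
  incl : A →ₐ[k] Ω
  incl_injective : Function.Injective incl
  range_incl : LinearMap.range incl.toLinearMap = deg 0
  d : Ω →ₗ[k] Ω
  d_mem : ∀ {n : ℕ} {x : Ω}, x ∈ deg n → d x ∈ deg (n + 1)
  d_d : ∀ x : Ω, d (d x) = 0
  leibniz : ∀ {n : ℕ} {x : Ω}, x ∈ deg n → ∀ y : Ω, d (x * y) = d x * y + (-1) ^ n * (x * d y)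
  surj : ∀ n : ℕ, deg n = Submodule.span k {x | ∃ (a₀ : A) (a : Fin n → A),
    x = incl a₀ * (List.ofFn fun i => d (incl (a i))).prod}

variable {k : Type w} {A Ω : Type u} [CommRing k] [Ring A] [Algebra k A] [Ring Ω] [Algebra k Ω]

namespace ExteriorCalculus

variable (C : ExteriorCalculus k A Ω)

/-- The `A`-bimodule `Ω^n` of `n`-forms. -/
def Form (n : ℕ) : Type u := C.deg n

namespace Form

variable {C} {n : ℕ}

instance : AddCommGroup (C.Form n) := Submodule.addCommGroup (C.deg n)

/-- The underlying element of the differential graded algebra. -/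
def val : C.Form n →+ Ω := (C.deg n).subtype.toAddMonoidHom

@[ext] theorem ext {x y : C.Form n} (h : val x = val y) : x = y := Subtype.ext h

theorem val_mem (x : C.Form n) : val x ∈ C.deg n := x.2

/-- The `n`-form given by an element of degree `n`. -/
def of (x : Ω) (hx : x ∈ C.deg n) : C.Form n := ⟨x, hx⟩

@[simp] theorem val_of (x : Ω) (hx : x ∈ C.deg n) : val (of (C := C) x hx) = x := rfl

end Form

theorem incl_mem (a : A) : C.incl a ∈ C.deg 0 := by
  rw [← C.range_incl]; exact ⟨a, rfl⟩

theorem mul_mem {m n : ℕ} {x y : Ω} (hx : x ∈ C.deg m) (hy : y ∈ C.deg n) :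
    x * y ∈ C.deg (m + n) :=
  haveI := C.graded
  SetLike.mul_mem_graded hx hy

namespace Form

variable {C} {n : ℕ}

instance : SMul A (C.Form n) :=
  ⟨fun a x => of (C.incl a * val x) (by simpa using C.mul_mem (C.incl_mem a) (val_mem x))⟩

instance : SMul Aᵐᵒᵖ (C.Form n) :=
  ⟨fun a x => of (val x * C.incl a.unop) (C.mul_mem (val_mem x) (C.incl_mem a.unop))⟩

@[simp] theorem val_smul (a : A) (x : C.Form n) : val (a • x) = C.incl a * val x := rfl

@[simp] theorem val_op_smul (a : Aᵐᵒᵖ) (x : C.Form n) : val (a • x) = val x * C.incl a.unop := rfl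

instance : Module A (C.Form n) where
  one_smul x := by ext; simp
  mul_smul a b x := by ext; simp [mul_assoc]
  smul_zero a := by ext; simp
  smul_add a x y := by ext; simp [mul_add]
  add_smul a b x := by ext; simp [add_mul]
  zero_smul x := by ext; simp

instance : Module Aᵐᵒᵖ (C.Form n) where
  one_smul x := by ext; simp
  mul_smul a b x := by ext; simp [mul_assoc]
  smul_zero a := by ext; simp
  smul_add a x y := by ext; simp [add_mul]
  add_smul a b x := by ext; simp [mul_add]
  zero_smul x := by ext; simp

instance : SMulCommClass A Aᵐᵒᵖ (C.Form n) where
  smul_comm a b x := by ext; simp [mul_assoc]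

end Form

open Form

/-- The differential `d : A → Ω^1`. -/
def dA : A →+ C.Form 1 where
  toFun a := of (C.d (C.incl a)) (C.d_mem (C.incl_mem a))
  map_zero' := by ext; simp
  map_add' a b := by ext; simp

@[simp] theorem val_dA (a : A) : val (C.dA a) = C.d (C.incl a) := rfl

/-- The differential `d : Ω^1 → Ω^2`. -/
def dOne : C.Form 1 →+ C.Form 2 where
  toFun x := of (C.d (val x)) (C.d_mem (val_mem x))
  map_zero' := by ext; simp
  map_add' a b := by ext; simp

@[simp] theorem val_dOne (x : C.Form 1) : val (C.dOne x) = C.d (val x) := rfl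

/-- The wedge product `Ω^1 × Ω^1 → Ω^2`; `C.wedge y` is `x ↦ x ∧ y`. -/
def wedge : C.Form 1 →+ (C.Form 1 →ₗ[A] C.Form 2) where
  toFun y :=
    { toFun := fun x => of (val x * val y) (C.mul_mem (val_mem x) (val_mem y))
      map_add' := fun x x' => by ext; simp [add_mul]
      map_smul' := fun a x => by ext; simp [mul_assoc] }
  map_zero' := by ext; simp
  map_add' y y' := by ext; simp [mul_add]

@[simp] theorem val_wedge (x y : C.Form 1) : val (C.wedge y x) = val x * val y := rfl

theorem d_incl_mul (a b : A) :
    C.d (C.incl (a * b)) = C.d (C.incl a) * C.incl b + C.incl a * C.d (C.incl b) := by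
  rw [map_mul, C.leibniz (C.incl_mem a)]; simp

theorem d_incl_mul_d (a b : A) :
    C.d (C.incl a * C.d (C.incl b)) = C.d (C.incl a) * C.d (C.incl b) := by
  rw [C.leibniz (C.incl_mem a), C.d_d]; simp

/-! ### The functors `E ↦ Ω^n ⊗_A E` and symmetric forms -/

section Forms

variable (E F : Type u) [AddCommGroup E] [Module A E] [AddCommGroup F] [Module A F]

/-- `Ω^n E = Ω^n ⊗_A E`. -/
abbrev FormT (n : ℕ) : Type u := BT A (C.Form n) E

variable {E F} in
/-- The functor `Ω^1` on morphisms. -/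
abbrev Om1 (g : E →ₗ[A] F) : C.FormT E 1 →ₗ[A] C.FormT F 1 := BT.map (C.Form 1) g

theorem wedge_op_smul (x y : C.Form 1) (a : A) :
    C.wedge (MulOpposite.op a • y) x = MulOpposite.op a • C.wedge y x := by
  ext; simp [mul_assoc]

theorem wedge_op_smul_left (x y : C.Form 1) (a : A) :
    C.wedge y (MulOpposite.op a • x) = C.wedge (a • y) x := by
  ext; simp [mul_assoc]

/-- `y ⊗ e ↦ (x ↦ (x ∧ y) ⊗ e)`. -/
def wedgeAux : C.FormT E 1 →+ (C.Form 1 →ₗ[A] C.FormT E 2) :=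
  BT.liftAdd
    { toFun := fun (y : C.Form 1) =>
        { toFun := fun (e : E) => (BT.mk (A := A) (M := C.Form 2) e).comp (C.wedge y)
          map_zero' := by ext x; simp
          map_add' := fun e e' => by ext x; simp }
      map_zero' := by ext e x; simp
      map_add' := fun y y' => by ext e x; simp [BT.add_tmul] }
    (fun y a e => by
      ext x
      simp [wedge_op_smul, BT.tmul_smul])

@[simp] theorem wedgeAux_tmul (x y : C.Form 1) (e : E) :
    C.wedgeAux E (BT.tmul A y e) x = BT.tmul A (C.wedge y x) e := rfl

/-- `∧ : Ω^1 ⊗_A (Ω^1 ⊗_A E) → Ω^2 ⊗_A E`. -/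
def wedgeT : C.FormT (C.FormT E 1) 1 →ₗ[A] C.FormT E 2 :=
  BT.lift (C.wedgeAux E)
    (fun x a z => by
      induction z using BT.induction with
      | h0 => simp
      | ht y e => rw [BT.smul_tmul', wedgeAux_tmul, wedgeAux_tmul, wedge_op_smul_left]
      | ha z z' h h' => simp only [smul_add, map_add, LinearMap.add_apply, h, h'])

@[simp] theorem wedgeT_tmul (x y : C.Form 1) (e : E) :
    C.wedgeT E (BT.tmul A x (BT.tmul A y e)) = BT.tmul A (C.wedge y x) e := rfl

end Forms

/-! ### 1-jets -/

section OneJets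

variable (E F G : Type u) [AddCommGroup E] [Module A E] [AddCommGroup F] [Module A F]
  [AddCommGroup G] [Module A G]

/-- Multiplication `A ⊗ A → A`. -/
def mulA : A ⊗[ℤ] A →ₗ[A] A := extend (AddMonoidHom.id A)

/-- `A ⊗ A → Ω^1`, `a ⊗ b ↦ a db`. -/
def symA : A ⊗[ℤ] A →ₗ[A] C.Form 1 := extend C.dA

/-- `N_d ⊆ A ⊗ A`: the elements `∑ aᵢ ⊗ bᵢ` with `∑ aᵢ bᵢ = 0` and `∑ aᵢ dbᵢ = 0`. -/
def Nd : Submodule A (A ⊗[ℤ] A) := LinearMap.ker (mulA (A := A)) ⊓ LinearMap.ker C.symA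

/-- `A ⊗ A → A ⊗ E`, `a ⊗ b ↦ a ⊗ b e`. -/
def actE {E : Type u} [AddCommGroup E] [Module A E] (e : E) : A ⊗[ℤ] A →ₗ[A] A ⊗[ℤ] E :=
  extend ((TensorProduct.mk ℤ A E 1).toAddMonoidHom.comp
    (LinearMap.toSpanSingleton A E e).toAddMonoidHom)

@[simp] theorem actE_tmul {E : Type u} [AddCommGroup E] [Module A E] (e : E) (a b : A) :
    actE e (a ⊗ₜ[ℤ] b) = a ⊗ₜ[ℤ] (b • e) := by
  simp [actE, TensorProduct.smul_tmul']

/-- `N_d E ⊆ A ⊗ E`, the span of the elements `∑ aᵢ ⊗ bᵢ e` with `∑ aᵢ ⊗ bᵢ ∈ N_d`. -/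
def NdE : Submodule A (A ⊗[ℤ] E) := ⨆ e : E, C.Nd.map (actE e)

/-- The 1-jet module `J^1 E = J^1 A ⊗_A E = (A ⊗ E) / N_d E`. Tensoring over `ℤ` or over `k`
gives the same quotient, because `c a ⊗ b - a ⊗ c b ∈ N_d` for `c ∈ k`. -/
def J1 : Type u := (A ⊗[ℤ] E) ⧸ C.NdE E

instance : AddCommGroup (C.J1 E) := Submodule.Quotient.addCommGroup (C.NdE E)
instance : Module A (C.J1 E) := Submodule.Quotient.module (C.NdE E)

/-- The quotient map `a ⊗ e ↦ [a ⊗ e]`. -/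
def J1mk : A ⊗[ℤ] E →ₗ[A] C.J1 E := (C.NdE E).mkQ

/-- The 1-jet prolongation `e ↦ [1 ⊗ e]`. -/
def j1 : E →+ C.J1 E := (C.J1mk E).toAddMonoidHom.comp (TensorProduct.mk ℤ A E 1).toAddMonoidHom

theorem J1mk_tmul (a : A) (e : E) : C.J1mk E (a ⊗ₜ[ℤ] e) = a • C.j1 E e := by
  change _ = a • C.J1mk E (1 ⊗ₜ[ℤ] e)
  rw [← map_smul, TensorProduct.smul_tmul', smul_eq_mul, mul_one]

variable {E F G}

theorem J1_induction {p : C.J1 E → Prop} (x : C.J1 E) (h0 : p 0)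
    (ht : ∀ (a : A) (e : E), p (a • C.j1 E e)) (ha : ∀ x y, p x → p y → p (x + y)) : p x := by
  obtain ⟨y, rfl⟩ := (C.NdE E).mkQ_surjective x
  induction y using TensorProduct.induction_on with
  | zero => rw [map_zero]; exact h0
  | tmul a e => exact (C.J1mk_tmul E a e) ▸ ht a e
  | add x y hx hy => rw [map_add]; exact ha _ _ hx hy

theorem J1mk_act (e : E) {x : A ⊗[ℤ] A} (hx : x ∈ C.Nd) : C.J1mk E (actE e x) = 0 :=
  (Submodule.Quotient.mk_eq_zero _).2
    (Submodule.mem_iSup_of_mem e (Submodule.mem_map_of_mem hx))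

theorem extend_actE (f : E →+ G) (e : E) (x : A ⊗[ℤ] A) :
    extend f (actE e x) =
      extend (A := A) (f.comp (LinearMap.toSpanSingleton A E e).toAddMonoidHom) x := by
  induction x using TensorProduct.induction_on with
  | zero => simp
  | tmul a b => simp
  | add x y hx hy => simp only [map_add, hx, hy]

/-- The `A`-linear lift `J^1 E → G`, `[a ⊗ e] ↦ a f(e)`, of an additive map `f : E → G` with
`∑ aᵢ f(bᵢ e) = 0` whenever `∑ aᵢ ⊗ bᵢ ∈ N_d`. -/
def J1lift (f : E →+ G) (hf : ∀ (e : E), ∀ x ∈ C.Nd,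
    extend (A := A) (f.comp (LinearMap.toSpanSingleton A E e).toAddMonoidHom) x = 0) :
    C.J1 E →ₗ[A] G :=
  (C.NdE E).liftQ (extend f) (by
    refine iSup_le fun e => ?_
    rintro _ ⟨x, hx, rfl⟩
    rw [LinearMap.mem_ker, extend_actE]
    exact hf e x hx)

@[simp] theorem J1lift_j1 (f : E →+ G) (hf) (e : E) : C.J1lift f hf (C.j1 E e) = f e := by
  change extend f (1 ⊗ₜ[ℤ] e) = f e
  simp

theorem extend_linear (f : A →ₗ[A] G) (x : A ⊗[ℤ] A) :
    extend (A := A) f.toAddMonoidHom x = f (mulA x) := by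
  induction x using TensorProduct.induction_on with
  | zero => simp
  | tmul a b =>
    change a • f b = f (a * b)
    rw [← smul_eq_mul, map_smul]
  | add x y hx hy => simp only [map_add, hx, hy]

variable (E) in
/-- The jet projection `π^{1,0}`, `[a ⊗ e] ↦ a e`. -/
def p1 : C.J1 E →ₗ[A] E :=
  C.J1lift (AddMonoidHom.id E) (fun e x hx => by
    have := extend_linear (LinearMap.toSpanSingleton A E e) x
    rw [show mulA x = 0 from hx.1, map_zero] at this
    exact this)

@[simp] theorem p1_j1 (e : E) : C.p1 E (C.j1 E e) = e := by simp [p1]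

theorem extend_j1 (e : E) (x : A ⊗[ℤ] A) :
    extend (A := A) ((C.j1 E).comp (LinearMap.toSpanSingleton A E e).toAddMonoidHom) x =
      C.J1mk E (actE e x) := by
  induction x using TensorProduct.induction_on with
  | zero => simp
  | tmul a b => simp [J1mk_tmul]
  | add x y hx hy => simp only [map_add, hx, hy]

/-- The functor `J^1` on morphisms, `[a ⊗ e] ↦ [a ⊗ g(e)]`. -/
def J1map (g : E →ₗ[A] F) : C.J1 E →ₗ[A] C.J1 F :=
  C.J1lift ((C.j1 F).comp g.toAddMonoidHom) (fun e x hx => by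
    have h : ((C.j1 F).comp g.toAddMonoidHom).comp
        (LinearMap.toSpanSingleton A E e).toAddMonoidHom =
        (C.j1 F).comp (LinearMap.toSpanSingleton A F (g e)).toAddMonoidHom := by
      ext b; simp
    rw [h, extend_j1, J1mk_act C _ hx])

@[simp] theorem J1map_j1 (g : E →ₗ[A] F) (e : E) :
    C.J1map g (C.j1 E e) = C.j1 F (g e) := by simp [J1map]

theorem symA_surjective : Function.Surjective C.symA := by
  intro ω
  have h : Form.val ω ∈ Submodule.span k {x | ∃ (a₀ : A) (a : Fin 1 → A),
      x = C.incl a₀ * (List.ofFn fun i => C.d (C.incl (a i))).prod} := by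
    rw [← C.surj 1]; exact Form.val_mem ω
  suffices H : ∃ x, Form.val (C.symA x) = Form.val ω by
    obtain ⟨x, hx⟩ := H
    exact ⟨x, Form.ext hx⟩
  generalize Form.val ω = z at h ⊢
  induction h using Submodule.span_induction with
  | mem x h =>
    obtain ⟨a₀, a, rfl⟩ := h
    exact ⟨a₀ ⊗ₜ a 0, by simp [symA]⟩
  | zero => exact ⟨0, by simp⟩
  | add x y _ _ hx hy =>
    obtain ⟨x', hx⟩ := hx
    obtain ⟨y', hy⟩ := hy
    exact ⟨x' + y', by rw [map_add, map_add, hx, hy]⟩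
  | smul c x _ hx =>
    obtain ⟨x', hx⟩ := hx
    exact ⟨algebraMap k A c • x', by rw [map_smul, Form.val_smul, hx]; simp [Algebra.smul_def]⟩

/-- `a ⊗ b ↦ [a ⊗ b e] - [a b ⊗ e]`. -/
def iotaPre : E →+ (A ⊗[ℤ] A →ₗ[A] C.J1 E) where
  toFun e := (C.J1mk E).comp (actE e) -
    (LinearMap.toSpanSingleton A (C.J1 E) (C.j1 E e)).comp mulA
  map_zero' := by
    apply LinearMap.ext; intro x
    induction x using TensorProduct.induction_on with
    | zero => simp
    | tmul a b => simp
    | add x y hx hy => simp only [map_add, hx, hy]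
  map_add' e e' := by
    apply LinearMap.ext; intro x
    induction x using TensorProduct.induction_on with
    | zero => simp
    | tmul a b => simp [J1mk_tmul]; abel
    | add x y hx hy => rw [map_add, hx, hy, map_add]

theorem iotaPre_tmul (e : E) (a b : A) :
    C.iotaPre e (a ⊗ₜ b) = a • C.j1 E (b • e) - (a * b) • C.j1 E e := by
  simp [iotaPre, J1mk_tmul, mulA]

theorem iotaPre_ker (e : E) : LinearMap.ker C.symA ≤ LinearMap.ker (C.iotaPre e) := by
  intro x hx
  have hx' : C.symA x = 0 := hx
  have hy : x - (mulA x) ⊗ₜ[ℤ] (1 : A) ∈ C.Nd := by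
    refine ⟨?_, ?_⟩
    · rw [SetLike.mem_coe, LinearMap.mem_ker, map_sub]
      simp [mulA]
    · have h1 : C.dA 1 = 0 := by
        have := C.d_incl_mul 1 1
        ext; simpa using this
      rw [SetLike.mem_coe, LinearMap.mem_ker, map_sub, hx']
      simp [symA, h1]
  have := C.J1mk_act e hy
  rw [LinearMap.mem_ker]
  rw [map_sub, map_sub, actE_tmul, J1mk_tmul, one_smul] at this
  exact this

/-- For `e : E`, the map `Ω^1 → J^1 E`, `a db ↦ [a ⊗ b e] - [a b ⊗ e]`. -/
def iotaAux (e : E) : C.Form 1 →ₗ[A] C.J1 E :=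
  ((LinearMap.ker C.symA).liftQ (C.iotaPre e) (C.iotaPre_ker e)).comp
    (C.symA.quotKerEquivOfSurjective C.symA_surjective).symm.toLinearMap

theorem iotaAux_symA (e : E) (x : A ⊗[ℤ] A) : C.iotaAux e (C.symA x) = C.iotaPre e x := by
  have : (C.symA.quotKerEquivOfSurjective C.symA_surjective).symm (C.symA x) =
      (LinearMap.ker C.symA).mkQ x := by
    rw [LinearEquiv.symm_apply_eq]; rfl
  simp [iotaAux, this]

variable (E) in
/-- The inclusion `ι^1 : Ω^1 ⊗_A E → J^1 E`, `a db ⊗ e ↦ [a ⊗ b e] - [a b ⊗ e]`. -/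
def iota1 : C.FormT E 1 →ₗ[A] C.J1 E :=
  BT.lift
    { toFun := C.iotaAux
      map_zero' := by
        ext ω
        obtain ⟨x, rfl⟩ := C.symA_surjective ω
        rw [iotaAux_symA, map_zero]; rfl
      map_add' := fun e e' => by
        ext ω
        obtain ⟨x, rfl⟩ := C.symA_surjective ω
        rw [LinearMap.add_apply, iotaAux_symA, iotaAux_symA, iotaAux_symA, map_add]; rfl }
    (fun ω c e => by
      obtain ⟨x, rfl⟩ := C.symA_surjective ω
      change C.iotaAux e _ = C.iotaAux (c • e) _
      induction x using TensorProduct.induction_on with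
      | zero => simp
      | tmul a b =>
        have h : MulOpposite.op c • C.symA (a ⊗ₜ b) =
            C.symA (a ⊗ₜ (b * c) - (a * b) ⊗ₜ c) := by
          ext
          simp [symA, C.d_incl_mul, -map_mul, map_mul C.incl a b, mul_add, mul_assoc]
        rw [h, iotaAux_symA, iotaAux_symA, map_sub, iotaPre_tmul, iotaPre_tmul, iotaPre_tmul]
        simp [mul_smul, mul_assoc]
      | add x y hx hy => simp only [map_add, smul_add, hx, hy])

@[simp] theorem iota1_tmul (a b : A) (e : E) :
    C.iota1 E (BT.tmul A (a • C.dA b) e) = a • C.j1 E (b • e) - (a * b) • C.j1 E e := by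
  rw [← iotaPre_tmul, ← iotaAux_symA]; rfl

theorem FormT_induction {p : C.FormT E 1 → Prop} (x : C.FormT E 1) (h0 : p 0)
    (ht : ∀ (a b : A) (e : E), p (BT.tmul A (a • C.dA b) e))
    (ha : ∀ x y, p x → p y → p (x + y)) : p x := by
  induction x using BT.induction with
  | h0 => exact h0
  | ht ω e =>
    obtain ⟨x, rfl⟩ := C.symA_surjective ω
    induction x using TensorProduct.induction_on with
    | zero => rw [map_zero, BT.zero_tmul]; exact h0
    | tmul a b => exact ht a b e
    | add x y hx hy => rw [map_add, BT.add_tmul]; exact ha _ _ hx hy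
  | ha x y hx hy => exact ha _ _ hx hy

end OneJets

/-! ### Holonomic jets and symmetric forms -/

section Holonomic

variable (E F : Type u) [AddCommGroup E] [Module A E] [AddCommGroup F] [Module A F]

/-- The underlying group of `(Ω^1 ⋉ Ω^2) E`, which is `Ω^1 E × Ω^2 E` with the left action
`a (α + β) = a α + da ∧ α + a β`. -/
def Semi : Type u := C.FormT E 1 × C.FormT E 2

instance : AddCommGroup (C.Semi E) :=
  Prod.instAddCommGroup (G := C.FormT E 1) (H := C.FormT E 2)

variable {E F}

theorem wedgeAux_smul (a : A) (z : C.FormT E 1) (x : C.Form 1) :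
    C.wedgeAux E (a • z) x = C.wedgeAux E z (MulOpposite.op a • x) := by
  induction z using BT.induction with
  | h0 => simp
  | ht y e => rw [BT.smul_tmul', wedgeAux_tmul, wedgeAux_tmul, wedge_op_smul_left]
  | ha z z' h h' => simp only [smul_add, map_add, LinearMap.add_apply, h, h']

theorem dA_mul (a b : A) : C.dA (a * b) = MulOpposite.op b • C.dA a + a • C.dA b := by
  ext; simp [-map_mul, d_incl_mul]

theorem dA_one : C.dA 1 = 0 := by
  have := C.dA_mul 1 1
  simpa using this

instance : Module A (C.Semi E) where
  smul a z := (a • z.1, C.wedgeAux E z.1 (C.dA a) + a • z.2)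
  one_smul z := by
    change ((1 : A) • z.1, C.wedgeAux E z.1 (C.dA 1) + (1 : A) • z.2) = z
    rw [dA_one, map_zero, one_smul, one_smul, zero_add]; rfl
  mul_smul a b z := by
    change ((a * b) • z.1, C.wedgeAux E z.1 (C.dA (a * b)) + (a * b) • z.2) =
      (a • b • z.1, C.wedgeAux E (b • z.1) (C.dA a) + a • (C.wedgeAux E z.1 (C.dA b) + b • z.2))
    rw [dA_mul, map_add, (C.wedgeAux E z.1).map_smul a (C.dA b), wedgeAux_smul, mul_smul, mul_smul,
      smul_add, add_assoc]
  smul_zero a := by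
    change (a • (0 : C.FormT E 1), C.wedgeAux E 0 (C.dA a) + a • (0 : C.FormT E 2)) = (0, 0)
    simp
  smul_add a z z' := by
    change (a • (z.1 + z'.1), C.wedgeAux E (z.1 + z'.1) (C.dA a) + a • (z.2 + z'.2)) =
      (a • z.1 + a • z'.1, C.wedgeAux E z.1 (C.dA a) + a • z.2 +
        (C.wedgeAux E z'.1 (C.dA a) + a • z'.2))
    rw [map_add, LinearMap.add_apply, smul_add, smul_add, add_add_add_comm]
  add_smul a b z := by
    change ((a + b) • z.1, C.wedgeAux E z.1 (C.dA (a + b)) + (a + b) • z.2) =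
      (a • z.1 + b • z.1, C.wedgeAux E z.1 (C.dA a) + a • z.2 +
        (C.wedgeAux E z.1 (C.dA b) + b • z.2))
    rw [map_add, map_add, add_smul, add_smul, add_add_add_comm]
  zero_smul z := by
    change ((0 : A) • z.1, C.wedgeAux E z.1 (C.dA 0) + (0 : A) • z.2) = (0, 0)
    simp

/-- The element `α + β` of `(Ω^1 ⋉ Ω^2) E`. -/
def Semi.mk (α : C.FormT E 1) (β : C.FormT E 2) : C.Semi E := (α, β)

theorem Semi.smul_mk (a : A) (α : C.FormT E 1) (β : C.FormT E 2) :
    a • Semi.mk C α β = Semi.mk C (a • α) (C.wedgeAux E α (C.dA a) + a • β) := rfl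

theorem Semi.mk_add (α α' : C.FormT E 1) (β β' : C.FormT E 2) :
    Semi.mk C α β + Semi.mk C α' β' = Semi.mk C (α + α') (β + β') := rfl

theorem Semi.mk_sub (α α' : C.FormT E 1) (β β' : C.FormT E 2) :
    Semi.mk C α β - Semi.mk C α' β' = Semi.mk C (α - α') (β - β') := rfl

theorem Semi.mk_zero : Semi.mk C (0 : C.FormT E 1) (0 : C.FormT E 2) = 0 := rfl

/-- `A ⊗ E → Ω^1 E`, `a ⊗ e ↦ da ⊗ e`. -/
def spencerPre : A ⊗[ℤ] E →+ C.FormT E 1 :=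
  TensorProduct.liftAddHom (R := ℤ)
    { toFun := fun a =>
        { toFun := fun e => BT.tmul A (C.dA a) e
          map_zero' := by rw [← BT.mk_apply, map_zero]; rfl
          map_add' := fun e e' => BT.tmul_add _ e e' }
      map_zero' := by ext e; simp [BT.zero_tmul]
      map_add' := fun a b => by ext e; simp [BT.add_tmul] }
    (fun r a e => by rw [map_zsmul, map_zsmul]; rfl)

@[simp] theorem spencerPre_tmul (a : A) (e : E) :
    C.spencerPre (a ⊗ₜ e) = BT.tmul A (C.dA a) e := rfl

theorem spencerPre_actE (e : E) (x : A ⊗[ℤ] A) :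
    C.spencerPre (actE e x) = BT.tmul A (C.dA (mulA x) - C.symA x) e := by
  induction x using TensorProduct.induction_on with
  | zero => simp [BT.zero_tmul]
  | tmul a b => simp [mulA, symA, dA_mul, BT.tmul_smul]
  | add x y hx hy =>
    rw [map_add, map_add, hx, hy, ← BT.add_tmul, map_add, map_add, map_add]
    congr 1; abel

variable (E) in
/-- The Spencer operator `J^1 E → Ω^1 E`, `[a ⊗ e] ↦ da ⊗ e`. -/
def spencer : C.J1 E →+ C.FormT E 1 :=
  QuotientAddGroup.lift (C.NdE E).toAddSubgroup C.spencerPre (by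
    intro x hx
    refine Submodule.iSup_induction (fun e : E => C.Nd.map (actE e)) (motive := fun x =>
      C.spencerPre x = 0) hx ?_ (map_zero _) (fun x y hx hy => by rw [map_add, hx, hy, add_zero])
    rintro e _ ⟨y, hy, rfl⟩
    rw [spencerPre_actE, show mulA y = 0 from hy.1, show C.symA y = 0 from hy.2]
    simp [BT.zero_tmul])

theorem spencer_smul_j1 (a : A) (e : E) :
    C.spencer E (a • C.j1 E e) = BT.tmul A (C.dA a) e := by
  rw [← J1mk_tmul]; rfl

theorem spencer_smul (b : A) (ξ : C.J1 E) :
    C.spencer E (b • ξ) = BT.tmul A (C.dA b) (C.p1 E ξ) + b • C.spencer E ξ := by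
  induction ξ using C.J1_induction with
  | h0 => rw [smul_zero, map_zero, map_zero, smul_zero, ← BT.mk_apply, map_zero]; simp
  | ht a e =>
    rw [smul_smul, spencer_smul_j1, spencer_smul_j1, map_smul, p1_j1, dA_mul, BT.add_tmul,
      BT.tmul_smul, BT.smul_tmul']
  | ha x y hx hy => rw [smul_add, map_add, hx, hy, map_add, map_add, BT.tmul_add, smul_add]; abel

/-- `ξ ↦ (da) ⊗ e + 0 ∈ (Ω^1 ⋉ Ω^2) E`, for `ξ = [a ⊗ e]`. -/
def spencerSemi : C.J1 E →+ C.Semi E where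
  toFun ξ := Semi.mk C (C.spencer E ξ) 0
  map_zero' := by rw [map_zero]; rfl
  map_add' ξ η := by rw [map_add, Semi.mk_add, add_zero]

theorem extend_spencerSemi (ξ : C.J1 E) (x : A ⊗[ℤ] A) :
    extend (A := A)
      (C.spencerSemi.comp (LinearMap.toSpanSingleton A (C.J1 E) ξ).toAddMonoidHom) x =
    Semi.mk C (BT.tmul A (C.symA x) (C.p1 E ξ) + mulA x • C.spencer E ξ)
      (BT.tmul A (C.dOne (C.symA x)) (C.p1 E ξ) +
        C.wedgeAux E (C.spencer E ξ) (C.dA (mulA x) - C.symA x)) := by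
  induction x using TensorProduct.induction_on with
  | zero => simp [BT.zero_tmul, Semi.mk_zero]
  | tmul a b =>
    have hd : C.dOne (a • C.dA b) = C.wedge (C.dA b) (C.dA a) := by
      ext; simp [d_incl_mul_d]
    have h1 : C.symA (a ⊗ₜ b) = a • C.dA b := rfl
    have h2 : mulA (a ⊗ₜ[ℤ] b) = a * b := rfl
    change a • Semi.mk C (C.spencer E (b • ξ)) 0 = _
    rw [Semi.smul_mk, spencer_smul, h1, h2, hd, dA_mul, add_sub_cancel_right, map_add,
      LinearMap.add_apply, wedgeAux_tmul, wedgeAux_smul, smul_add, BT.smul_tmul', mul_smul,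
      smul_zero, add_zero]
  | add x y hx hy =>
    rw [map_add, hx, hy, Semi.mk_add]
    congr 1
    · rw [map_add, BT.add_tmul, map_add, add_smul, add_add_add_comm]
    · rw [map_add, map_add, BT.add_tmul, map_add, map_add, add_sub_add_comm, map_add,
        add_add_add_comm]

variable (E) in
/-- The map `J^1 J^1 E → (Ω^1 ⋉ Ω^2) E`,
`[a ⊗ b] ⊗ [c ⊗ e] ↦ a d(b c) ⊗ e + da ∧ d(b c) ⊗ e`. -/
def DT : C.J1 (C.J1 E) →ₗ[A] C.Semi E :=
  C.J1lift C.spencerSemi (fun ξ x hx => by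
    rw [extend_spencerSemi, show mulA x = 0 from hx.1, show C.symA x = 0 from hx.2]
    simp [BT.zero_tmul, Semi.mk_zero])

theorem DT_j1 (ξ : C.J1 E) : C.DT E (C.j1 _ ξ) = Semi.mk C (C.spencer E ξ) 0 := by
  rw [DT, J1lift_j1]; rfl

/-- The defining formula of `DT` on generators. -/
theorem DT_apply (a b c : A) (e : E) :
    C.DT E (a • C.j1 _ (b • c • C.j1 E e)) =
      Semi.mk C (BT.tmul A (a • C.dA (b * c)) e)
        (BT.tmul A (C.wedge (C.dA (b * c)) (C.dA a)) e) := by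
  rw [(C.DT E).map_smul, DT_j1, smul_smul, spencer_smul_j1, Semi.smul_mk, BT.smul_tmul',
    wedgeAux_tmul, smul_zero, add_zero]

theorem p1_iota1 (z : C.FormT E 1) : C.p1 E (C.iota1 E z) = 0 := by
  induction z using C.FormT_induction with
  | h0 => simp
  | ht a b e => simp [mul_smul]
  | ha x y hx hy => rw [map_add, map_add, hx, hy, add_zero]

theorem spencer_iota1 (z : C.FormT E 1) : C.spencer E (C.iota1 E z) = -z := by
  induction z using C.FormT_induction with
  | h0 => simp
  | ht a b e =>
    rw [iota1_tmul, map_sub, spencer_smul_j1, spencer_smul_j1, BT.tmul_smul, dA_mul, BT.add_tmul]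
    abel
  | ha x y hx hy => rw [map_add, map_add, hx, hy, neg_add]

theorem DT_iota1 (z : C.FormT (C.FormT E 1) 1) :
    C.DT E (C.iota1 _ (C.Om1 (C.iota1 E) z)) = Semi.mk C 0 (C.wedgeT E z) := by
  induction z using C.FormT_induction with
  | h0 => simp [Semi.mk_zero]
  | ht a b α =>
    have h0 : BT.tmul A (C.dA b) (0 : E) = 0 := by rw [← BT.mk_apply, map_zero]; rfl
    have hw : C.wedgeT E (BT.tmul A (a • C.dA b) α) = C.wedgeAux E α (a • C.dA b) := rfl
    rw [BT.map_tmul, iota1_tmul, map_sub, (C.DT E).map_smul, (C.DT E).map_smul, DT_j1, DT_j1,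
      spencer_smul, p1_iota1, spencer_iota1, Semi.smul_mk, Semi.smul_mk, h0, hw, zero_add,
      Semi.mk_sub, dA_mul, smul_zero, smul_zero, add_zero, add_zero]
    congr 1
    · rw [smul_neg, smul_neg, smul_neg, smul_smul, sub_self]
    · rw [smul_neg, ← neg_smul, wedgeAux_smul, map_neg, map_add, LinearMap.neg_apply]
      simp
  | ha x y hx hy => rw [map_add, map_add, map_add, hx, hy, map_add, Semi.mk_add, add_zero]

theorem J1map_iota1 (g : E →ₗ[A] F) (z : C.FormT E 1) :
    C.J1map g (C.iota1 E z) = C.iota1 F (C.Om1 g z) := by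
  induction z using C.FormT_induction with
  | h0 => simp
  | ht a b e => simp
  | ha x y hx hy => simp only [map_add, hx, hy]

theorem wedgeT_map (g : E →ₗ[A] F) (z : C.FormT (C.FormT E 1) 1) :
    C.wedgeT F (C.Om1 (C.Om1 g) z) = BT.map (C.Form 2) g (C.wedgeT E z) := by
  induction z using BT.induction with
  | h0 => simp
  | ht x y =>
    induction y using BT.induction with
    | h0 => rw [← BT.mk_apply, map_zero]; simp
    | ht y e => simp
    | ha y y' h h' => rw [BT.tmul_add, map_add, map_add, h, h', map_add, map_add]
  | ha x y hx hy => simp only [map_add, hx, hy]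

theorem Om1_comp {G : Type u} [AddCommGroup G] [Module A G] (g : F →ₗ[A] G) (f : E →ₗ[A] F)
    (z : C.FormT E 1) : C.Om1 g (C.Om1 f z) = C.Om1 (g.comp f) z := by
  induction z using BT.induction with
  | h0 => simp
  | ht x y => simp
  | ha x y hx hy => simp only [map_add, hx, hy]

/-- The kernel of `J^1 E → J^1 J^1 F → (Ω^1 ⋉ Ω^2) F`, for a map `l : E → J^1 F`. -/
def jetKer (l : E →ₗ[A] C.J1 F) : Submodule A (C.J1 E) :=
  LinearMap.ker ((C.DT F).comp (C.J1map l))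

theorem mem_jetKer {l : E →ₗ[A] C.J1 F} {x : C.J1 E} :
    x ∈ C.jetKer l ↔ C.DT F (C.J1map l x) = 0 := Iff.rfl

/-- The kernel of `Ω^1 E → Ω^1 Ω^1 F → Ω^2 F`, for a map `i : E → Ω^1 F`. -/
def symKer (i : E →ₗ[A] C.FormT F 1) : Submodule A (C.FormT E 1) :=
  LinearMap.ker ((C.wedgeT F).comp (C.Om1 i))

theorem mem_symKer {i : E →ₗ[A] C.FormT F 1} {x : C.FormT E 1} :
    x ∈ C.symKer i ↔ C.wedgeT F (C.Om1 i x) = 0 := Iff.rfl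

variable (E)

/-- Pairs of left `A`-modules `P`, `Q` with a map `Q → J^1 P`. -/
abbrev JetPair : Type (u + 1) := Σ P : ModuleCat.{u} A, Σ Q : ModuleCat.{u} A, (Q →ₗ[A] C.J1 P)

/-- The modules `J^n E`, `J^{n+1} E` and the inclusion `J^{n+1} E → J^1 J^n E`. -/
def jetPair : ℕ → C.JetPair
  | 0 => ⟨ModuleCat.of A E, ModuleCat.of A (C.J1 E), LinearMap.id⟩
  | n + 1 => ⟨(jetPair n).2.1,
      ModuleCat.of A (C.jetKer (jetPair n).2.2), Submodule.subtype _⟩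

/-- The module of holonomic `n`-jets: `J^0 E = E`, `J^1 E` is the 1-jet module, and
`J^n E = ker (J^1 J^{n-1} E → J^1 J^1 J^{n-2} E → (Ω^1 ⋉ Ω^2) J^{n-2} E)`. -/
def Jet (n : ℕ) : Type u := (C.jetPair E n).1

instance (n : ℕ) : AddCommGroup (C.Jet E n) := (C.jetPair E n).1.isAddCommGroup
instance (n : ℕ) : Module A (C.Jet E n) := (C.jetPair E n).1.isModule

/-- The inclusion `l^{1,n} : J^{n+1} E → J^1 J^n E`. -/
def lJet (n : ℕ) : C.Jet E (n + 1) →ₗ[A] C.J1 (C.Jet E n) := (C.jetPair E n).2.2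

/-- The jet projection `π^{n+1,n}`. -/
def piJet (n : ℕ) : C.Jet E (n + 1) →ₗ[A] C.Jet E n := (C.p1 (C.Jet E n)).comp (C.lJet E n)

/-- An element of `J^{n+2} E` from an element of `J^1 J^{n+1} E` in the kernel. -/
def mkJet (n : ℕ) (x : C.J1 (C.Jet E (n + 1))) (hx : x ∈ C.jetKer (C.lJet E n)) :
    C.Jet E (n + 2) :=
  (⟨x, hx⟩ : C.jetKer (C.lJet E n))

@[simp] theorem lJet_mkJet (n : ℕ) (x : C.J1 (C.Jet E (n + 1)))
    (hx : x ∈ C.jetKer (C.lJet E n)) :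
    C.lJet E (n + 1) (C.mkJet E n x hx) = x := rfl

theorem lJet_injective (n : ℕ) : Function.Injective (C.lJet E n) := by
  cases n with
  | zero => exact Function.injective_id
  | succ n => exact Subtype.val_injective

theorem lJet_mem (n : ℕ) (x : C.Jet E (n + 2)) :
    C.lJet E (n + 1) x ∈ C.jetKer (C.lJet E n) :=
  Subtype.property (p := fun x => x ∈ C.jetKer (C.lJet E n)) x

/-- The prolongations `j^n`, `j^{n+1}`, with `l^{1,n} ∘ j^{n+1} = j^1 ∘ j^n`. -/
def jPair : (n : ℕ) → {p : (E →+ C.Jet E n) × (E →+ C.Jet E (n + 1)) //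
    ∀ e, C.lJet E n (p.2 e) = C.j1 (C.Jet E n) (p.1 e)}
  | 0 => ⟨(AddMonoidHom.id E, C.j1 E), fun _ => rfl⟩
  | n + 1 =>
    ⟨((jPair n).1.2,
      { toFun := fun e => C.mkJet E n (C.j1 _ ((jPair n).1.2 e)) (by
          rw [mem_jetKer, J1map_j1, (jPair n).2, DT_j1, ← one_smul A (C.j1 _ ((jPair n).1.1 e)),
            spencer_smul_j1, dA_one, BT.zero_tmul, Semi.mk_zero])
        map_zero' := C.lJet_injective E (n + 1) (by simp)
        map_add' := fun e e' => C.lJet_injective E (n + 1) (by simp) }), fun _ => rfl⟩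

/-- The jet prolongation `j^n : E → J^n E`. -/
def jJet (n : ℕ) : E →+ C.Jet E n := (C.jPair E n).1.1

theorem lJet_jJet (n : ℕ) (e : E) :
    C.lJet E n (C.jJet E (n + 1) e) = C.j1 (C.Jet E n) (C.jJet E n e) := (C.jPair E n).2 e

/-- Pairs of left `A`-modules `P`, `Q` with a map `Q → Ω^1 P`. -/
abbrev SymPair : Type (u + 1) :=
  Σ P : ModuleCat.{u} A, Σ Q : ModuleCat.{u} A, (Q →ₗ[A] C.FormT P 1)

/-- The modules `S^n E`, `S^{n+1} E` and the inclusion `S^{n+1} E → Ω^1 S^n E`. -/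
def symPair : ℕ → C.SymPair
  | 0 => ⟨ModuleCat.of A E, ModuleCat.of A (C.FormT E 1), LinearMap.id⟩
  | n + 1 => ⟨(symPair n).2.1,
      ModuleCat.of A (C.symKer (symPair n).2.2), Submodule.subtype _⟩

/-- Symmetric `n`-forms with values in `E`: `S^0 E = E`, `S^1 E = Ω^1 E`, and
`S^n E = ker (Ω^1 S^{n-1} E → Ω^1 Ω^1 S^{n-2} E → Ω^2 S^{n-2} E)`. -/
def Sym (n : ℕ) : Type u := (C.symPair E n).1

instance (n : ℕ) : AddCommGroup (C.Sym E n) := (C.symPair E n).1.isAddCommGroup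
instance (n : ℕ) : Module A (C.Sym E n) := (C.symPair E n).1.isModule

/-- The inclusion `ι_∧^{n+1} : S^{n+1} E → Ω^1 S^n E`. -/
def iotaW (n : ℕ) : C.Sym E (n + 1) →ₗ[A] C.FormT (C.Sym E n) 1 := (C.symPair E n).2.2

/-- An element of `S^{n+2} E` from an element of `Ω^1 S^{n+1} E` in the kernel. -/
def mkSym (n : ℕ) (x : C.FormT (C.Sym E (n + 1)) 1)
    (hx : x ∈ C.symKer (C.iotaW E n)) : C.Sym E (n + 2) :=
  (⟨x, hx⟩ : C.symKer (C.iotaW E n))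

@[simp] theorem iotaW_mkSym (n : ℕ) (x : C.FormT (C.Sym E (n + 1)) 1)
    (hx : x ∈ C.symKer (C.iotaW E n)) :
    C.iotaW E (n + 1) (C.mkSym E n x hx) = x := rfl

theorem iotaW_injective (n : ℕ) : Function.Injective (C.iotaW E n) := by
  cases n with
  | zero => exact Function.injective_id
  | succ n => exact Subtype.val_injective

/-- The map into `S^{n+2} E` induced by a map into the kernel. -/
def toSym {M : Type u} [AddCommGroup M] [Module A M] (n : ℕ)
    (f : M →ₗ[A] C.FormT (C.Sym E (n + 1)) 1)
    (hf : ∀ x, f x ∈ C.symKer (C.iotaW E n)) : M →ₗ[A] C.Sym E (n + 2) :=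
  { toFun := fun x => C.mkSym E n (f x) (hf x)
    map_add' := fun x y => C.iotaW_injective E (n + 1) (by simp)
    map_smul' := fun a x => C.iotaW_injective E (n + 1) (by simp) }

@[simp] theorem iotaW_toSym {M : Type u} [AddCommGroup M] [Module A M] (n : ℕ)
    (f : M →ₗ[A] C.FormT (C.Sym E (n + 1)) 1)
    (hf : ∀ x, f x ∈ C.symKer (C.iotaW E n)) (x : M) :
    C.iotaW E (n + 1) (C.toSym E n f hf x) = f x := rfl

theorem iotaW_mem (n : ℕ) (x : C.Sym E (n + 2)) :
    C.wedgeT (C.Sym E n) (C.Om1 (C.iotaW E n) (C.iotaW E (n + 1) x)) = 0 :=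
  Subtype.property (p := fun x => x ∈ C.symKer (C.iotaW E n)) x

/-- The map into `J^{n+2} E` induced by a map into the kernel. -/
def toJet {M : Type u} [AddCommGroup M] [Module A M] (n : ℕ)
    (f : M →ₗ[A] C.J1 (C.Jet E (n + 1)))
    (hf : ∀ x, f x ∈ C.jetKer (C.lJet E n)) : M →ₗ[A] C.Jet E (n + 2) :=
  { toFun := fun x => C.mkJet E n (f x) (hf x)
    map_add' := fun x y => C.lJet_injective E (n + 1) (by simp)
    map_smul' := fun a x => C.lJet_injective E (n + 1) (by simp) }

/-- The inclusions `ι^n`, `ι^{n+1}`, with `l^{1,n} ∘ ι^{n+1} = ι^1 ∘ Ω^1(ι^n) ∘ ι_∧^{n+1}`. -/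
def iotaPair : (n : ℕ) → {p : (C.Sym E n →ₗ[A] C.Jet E n) × (C.Sym E (n + 1) →ₗ[A] C.Jet E (n + 1))
    // ∀ x, C.lJet E n (p.2 x) = C.iota1 (C.Jet E n) (C.Om1 p.1 (C.iotaW E n x))}
  | 0 => ⟨(LinearMap.id, C.iota1 E), fun x => by
      have h : ∀ z : C.FormT E 1, C.Om1 (LinearMap.id : E →ₗ[A] E) z = z := fun z => by
        induction z using BT.induction with
        | h0 => simp
        | ht x y => simp
        | ha x y hx hy => rw [map_add, hx, hy]
      exact (congrArg (C.iota1 E) (h x)).symm⟩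
  | n + 1 =>
    ⟨((iotaPair n).1.2,
      C.toJet E n ((C.iota1 _).comp ((C.Om1 (iotaPair n).1.2).comp (C.iotaW E (n + 1)))) (by
        intro x
        have h : (C.lJet E n).comp (iotaPair n).1.2 =
            (C.iota1 (C.Jet E n)).comp ((C.Om1 (iotaPair n).1.1).comp (C.iotaW E n)) :=
          LinearMap.ext (iotaPair n).2
        rw [mem_jetKer, LinearMap.comp_apply, LinearMap.comp_apply, J1map_iota1, Om1_comp, h, ← Om1_comp,
          ← Om1_comp, DT_iota1, wedgeT_map, iotaW_mem, map_zero, Semi.mk_zero])), fun _ => rfl⟩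

/-- The inclusion `ι^n : S^n E → J^n E`. -/
def iotaJet (n : ℕ) : C.Sym E n →ₗ[A] C.Jet E n := (C.iotaPair E n).1.1

theorem lJet_iotaJet (n : ℕ) (x : C.Sym E (n + 1)) :
    C.lJet E n (C.iotaJet E (n + 1) x) =
      C.iota1 (C.Jet E n) (C.Om1 (C.iotaJet E n) (C.iotaW E n x)) := (C.iotaPair E n).2 x

variable {E}

/-- The maps `S^n(g)`, `S^{n+1}(g)`. -/
def symMapPair (g : E →ₗ[A] F) : (n : ℕ) →
    {p : (C.Sym E n →ₗ[A] C.Sym F n) × (C.Sym E (n + 1) →ₗ[A] C.Sym F (n + 1)) //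
      ∀ x, C.iotaW F n (p.2 x) = C.Om1 p.1 (C.iotaW E n x)}
  | 0 => ⟨(g, C.Om1 g), fun _ => rfl⟩
  | n + 1 =>
    ⟨((symMapPair g n).1.2,
      C.toSym F n ((C.Om1 (symMapPair g n).1.2).comp (C.iotaW E (n + 1))) (by
        intro x
        have h : (C.iotaW F n).comp (symMapPair g n).1.2 =
            (C.Om1 (symMapPair g n).1.1).comp (C.iotaW E n) :=
          LinearMap.ext (symMapPair g n).2
        rw [mem_symKer, LinearMap.comp_apply, Om1_comp, h, ← Om1_comp, wedgeT_map, iotaW_mem, map_zero])),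
      fun _ => rfl⟩

/-- The functor `S^n` on morphisms. -/
def symMap (g : E →ₗ[A] F) (n : ℕ) : C.Sym E n →ₗ[A] C.Sym F n := (C.symMapPair g n).1.1

theorem iotaW_symMap (g : E →ₗ[A] F) (n : ℕ) (x : C.Sym E (n + 1)) :
    C.iotaW F n (C.symMap g (n + 1) x) = C.Om1 (C.symMap g n) (C.iotaW E n x) :=
  (C.symMapPair g n).2 x

end Holonomic

/-! ### Connections -/

section Connections

/-- A left connection `∇ : E → Ω^1 E`; it is `k`-linear by the Leibniz rule, since `d` vanishes on
the image of `k`. -/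
structure LeftConnection (E : Type u) [AddCommGroup E] [Module A E] where
  nabla : E →+ C.FormT E 1
  leibniz : ∀ (a : A) (e : E), nabla (a • e) = a • nabla e + BT.tmul A (C.dA a) e

/-- Right multiplication by `a` on `Ω^1`. -/
def rmul (a : A) : C.Form 1 →ₗ[A] C.Form 1 where
  toFun ω := MulOpposite.op a • ω
  map_add' := smul_add _
  map_smul' b ω := (smul_comm b (MulOpposite.op a) ω).symm

@[simp] theorem rmul_apply (a : A) (ω : C.Form 1) : C.rmul a ω = MulOpposite.op a • ω := rfl

/-- A bimodule connection on `Ω^1`: a left connection `∇` together with a bimodule map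
`σ : Ω^1 ⊗_A Ω^1 → Ω^1 ⊗_A Ω^1` such that `∇(ω a) = ∇(ω) a + σ(ω ⊗ da)`. -/
structure BimoduleConnection extends C.LeftConnection (C.Form 1) where
  sigma : C.FormT (C.Form 1) 1 →ₗ[A] C.FormT (C.Form 1) 1
  sigma_right : ∀ (a : A) (x : C.FormT (C.Form 1) 1),
    sigma (C.Om1 (C.rmul a) x) = C.Om1 (C.rmul a) (sigma x)
  leibniz_right : ∀ (ω : C.Form 1) (a : A),
    nabla (MulOpposite.op a • ω) = C.Om1 (C.rmul a) (nabla ω) + sigma (BT.tmul A ω (C.dA a))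

variable {C} {F : Type u} [AddCommGroup F] [Module A F]

theorem mk_comp_rmul (a : A) (f : F) (x : C.FormT (C.Form 1) 1) :
    C.Om1 (BT.mk (A := A) (M := C.Form 1) f) (C.Om1 (C.rmul a) x) =
      C.Om1 (BT.mk (A := A) (M := C.Form 1) (a • f)) x := by
  rw [Om1_comp]
  congr 1
  congr 1
  ext ω
  simp [BT.tmul_smul]

theorem Om1_add {E : Type u} [AddCommGroup E] [Module A E] (g g' : E →ₗ[A] F)
    (x : C.FormT E 1) : C.Om1 (g + g') x = C.Om1 g x + C.Om1 g' x := by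
  induction x using BT.induction with
  | h0 => simp
  | ht ω e => simp [BT.tmul_add]
  | ha x y hx hy => rw [map_add, hx, hy, map_add, map_add, add_add_add_comm]

theorem Om1_zero {E : Type u} [AddCommGroup E] [Module A E]
    (x : C.FormT E 1) : C.Om1 (0 : E →ₗ[A] F) x = 0 := by
  have := Om1_add (C := C) (0 : E →ₗ[A] F) 0 x
  simpa using this

/-- `x ↦ (f ↦ x ⊗ f)`, for `x ∈ Ω^1 ⊗_A Ω^1`. -/
def tensF (F : Type u) [AddCommGroup F] [Module A F] :
    C.FormT (C.Form 1) 1 →+ F →+ C.FormT (C.FormT F 1) 1 where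
  toFun x :=
    { toFun := fun f => C.Om1 (BT.mk (A := A) (M := C.Form 1) f) x
      map_zero' := by rw [map_zero, Om1_zero]
      map_add' := fun f f' => by rw [map_add, Om1_add] }
  map_zero' := by ext f; simp
  map_add' x y := by ext f; simp

theorem tensF_apply (x : C.FormT (C.Form 1) 1) (f : F) :
    tensF F x f = C.Om1 (BT.mk (A := A) (M := C.Form 1) f) x := rfl

namespace BimoduleConnection

variable (D : C.BimoduleConnection)

/-- `η ⊗ f ↦ (ω ↦ σ(ω ⊗ η) ⊗ f)`. -/
def sigmaAux (F : Type u) [AddCommGroup F] [Module A F] :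
    C.FormT F 1 →+ (C.Form 1 →ₗ[A] C.FormT (C.FormT F 1) 1) :=
  BT.liftAdd
    { toFun := fun (η : C.Form 1) =>
        { toFun := fun (f : F) => (C.Om1 (BT.mk (A := A) (M := C.Form 1) f)).comp
            (D.sigma.comp (BT.mk (A := A) (M := C.Form 1) η))
          map_zero' := by ext ω; simp [Om1_zero]
          map_add' := fun f f' => by ext ω; simp [Om1_add] }
      map_zero' := by ext f ω; simp
      map_add' := fun η η' => by ext f ω; simp }
    (fun η a f => by
      ext ω
      change C.Om1 (BT.mk (A := A) f) (D.sigma (BT.tmul A ω (MulOpposite.op a • η))) =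
        C.Om1 (BT.mk (A := A) (a • f)) (D.sigma (BT.tmul A ω η))
      rw [← mk_comp_rmul, ← D.sigma_right]
      simp)

theorem sigmaAux_tmul (ω η : C.Form 1) (f : F) :
    D.sigmaAux F (BT.tmul A η f) ω = C.Om1 (BT.mk (A := A) f) (D.sigma (BT.tmul A ω η)) := rfl

theorem sigmaAux_smul (ω : C.Form 1) (a : A) (z : C.FormT F 1) :
    D.sigmaAux F z (MulOpposite.op a • ω) = D.sigmaAux F (a • z) ω := by
  induction z using BT.induction with
  | h0 => simp
  | ht η f => rw [BT.smul_tmul', sigmaAux_tmul, sigmaAux_tmul, BT.tmul_smul]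
  | ha x y hx hy => simp only [smul_add, map_add, LinearMap.add_apply, hx, hy]

/-- The map `σ ⊗_A id_F : Ω^1 Ω^1 F → Ω^1 Ω^1 F`. -/
def sigmaT (F : Type u) [AddCommGroup F] [Module A F] :
    C.FormT (C.FormT F 1) 1 →ₗ[A] C.FormT (C.FormT F 1) 1 :=
  BT.lift (D.sigmaAux F) (fun ω a z => D.sigmaAux_smul ω a z)

@[simp] theorem sigmaT_tmul (ω η : C.Form 1) (f : F) :
    D.sigmaT F (BT.tmul A ω (BT.tmul A η f)) =
      C.Om1 (BT.mk (A := A) f) (D.sigma (BT.tmul A ω η)) := rfl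

/-- `ω ↦ (f ↦ (σ ⊗ id_F)(ω ⊗ ∇(f)))`. -/
def sigmaNabla (N : C.LeftConnection F) : C.Form 1 →+ F →+ C.FormT (C.FormT F 1) 1 where
  toFun ω := (AddMonoidHom.flip (AddMonoidHom.mk' (fun z => (D.sigmaAux F z).toAddMonoidHom)
    (fun z z' => by ext x; simp)) ω).comp N.nabla
  map_zero' := by ext f; simp
  map_add' ω ω' := by ext f; simp

theorem sigmaNabla_apply (N : C.LeftConnection F) (ω : C.Form 1) (f : F) :
    D.sigmaNabla N ω f = D.sigmaT F (BT.tmul A ω (N.nabla f)) := rfl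

/-- The tensor product connection `Ω^1 F → Ω^1 Ω^1 F` of a bimodule connection on `Ω^1` and a left
connection on `F`, `ω ⊗ f ↦ ∇(ω) ⊗ f + (σ ⊗ id_F)(ω ⊗ ∇(f))`, as an additive map. -/
def tensorConn (N : C.LeftConnection F) : C.FormT F 1 →+ C.FormT (C.FormT F 1) 1 :=
  BT.liftAdd ((tensF F).comp D.nabla + D.sigmaNabla N) (fun ω a f => by
    simp only [AddMonoidHom.add_apply, AddMonoidHom.comp_apply, tensF_apply, sigmaNabla_apply,
      D.leibniz_right, N.leibniz, map_add, BT.tmul_add, mk_comp_rmul, sigmaT_tmul, BT.tmul_smul]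
    abel)

theorem tensorConn_tmul (N : C.LeftConnection F) (ω : C.Form 1) (f : F) :
    D.tensorConn N (BT.tmul A ω f) =
      C.Om1 (BT.mk (A := A) f) (D.nabla ω) + D.sigmaT F (BT.tmul A ω (N.nabla f)) := rfl

end BimoduleConnection

end Connections

/-! ### Retractions and iterated connections -/

section Iterated

variable (E : Type u) [AddCommGroup E] [Module A E]

/-- `s^n : Ω^1 S^n E → S^{n+1} E` is a retraction of the inclusion `ι_∧^{n+1}`, for all `n`. -/
def IsRetraction (s : ∀ n : ℕ, C.FormT (C.Sym E n) 1 →ₗ[A] C.Sym E (n + 1)) : Prop :=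
  ∀ (n : ℕ) (x : C.Sym E (n + 1)), s n (C.iotaW E n x) = x

variable {E}

/-- The operators `∇^n = s^{n-1} ∘ ∇^{S^{n-1} E} ∘ ⋯ ∘ s^0 ∘ ∇^E : E → S^n E`. -/
def iterNabla (s : ∀ n : ℕ, C.FormT (C.Sym E n) 1 →ₗ[A] C.Sym E (n + 1))
    (N : ∀ n : ℕ, C.LeftConnection (C.Sym E n)) : (n : ℕ) → E →+ C.Sym E n
  | 0 => AddMonoidHom.id E
  | n + 1 => (s n).toAddMonoidHom.comp ((N n).nabla.comp (iterNabla s N n))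

/-- `N` is the family of connections on the modules `S^n E` built from a bimodule connection `D`
on `Ω^1`, a left connection `N₀` on `E` and maps `s^n : Ω^1 S^n E → S^{n+1} E`: it starts with
`N₀`, and `∇^{S^{n+1} E} = Ω^1(s^n) ∘ ∇^{Ω^1 S^n E} ∘ ι_∧^{n+1}`. -/
def IsInducedConnection (D : C.BimoduleConnection) (N₀ : C.LeftConnection E)
    (s : ∀ n : ℕ, C.FormT (C.Sym E n) 1 →ₗ[A] C.Sym E (n + 1))
    (N : ∀ n : ℕ, C.LeftConnection (C.Sym E n)) : Prop :=
  N 0 = N₀ ∧ ∀ (n : ℕ) (x : C.Sym E (n + 1)),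
    (N (n + 1)).nabla x = C.Om1 (s n) (D.tensorConn (N n) (C.iotaW E n x))

end Iterated

/-! ### Differential operators, symbols and quantizations -/

section Quantization

variable (E : Type u) [AddCommGroup E] [Module A E]

/-- `J^n E` is elemental for all `n`: it is generated over `A` by the image of `j^n`. -/
def Elemental : Prop := ∀ n : ℕ, Submodule.span A (Set.range (C.jJet E n)) = ⊤

/-- The `n`-jet sequences `S^n E → J^n E → J^{n-1} E → 0` at `E` are exact, for all `n ≥ 1`. -/
def RightExact : Prop := ∀ n : ℕ,
  Function.Exact (C.iotaJet E (n + 1)) (C.piJet E n) ∧ Function.Surjective (C.piJet E n)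

variable (F G : Type u) [AddCommGroup F] [Module A F] [Module k F]
  [IsScalarTower k A F] [AddCommGroup G] [Module A G] [Module k G] [IsScalarTower k A G]

variable [Module k E]

/-- The linear differential operators `E → F` of order at most `n`: the maps which factor as
`Δ̃ ∘ j^n` for some left `A`-linear `Δ̃ : J^n E → F`. -/
def Diff (n : ℕ) : Submodule k (E →ₗ[k] F) where
  carrier := {Δ | ∃ L : C.Jet E n →ₗ[A] F, ∀ e, Δ e = L (C.jJet E n e)}
  zero_mem' := ⟨0, fun _ => rfl⟩
  add_mem' := by
    rintro Δ Δ' ⟨L, h⟩ ⟨L', h'⟩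
    exact ⟨L + L', fun e => by simp [h, h']⟩
  smul_mem' := by
    rintro c Δ ⟨L, h⟩
    refine ⟨
      { toFun := fun x => c • L x
        map_add' := fun x y => by rw [map_add, smul_add]
        map_smul' := fun a x => by
          rw [map_smul, RingHom.id_apply, ← algebraMap_smul A c (a • L x),
            ← algebraMap_smul A c (L x), smul_smul, smul_smul, Algebra.commutes] }, fun e => ?_⟩
    simp [h]

/-- The differential operators of order strictly less than `n`. -/
def DiffLT : ℕ → Submodule k (E →ₗ[k] F)
  | 0 => ⊥
  | n + 1 => C.Diff E F n

/-- All differential operators `E → F` of finite order. -/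
def DiffAll : Submodule k (E →ₗ[k] F) := ⨆ n, C.Diff E F n

/-- The symbols of order `n`, `Symb^n(E, F) = Diff^n(E, F) / Diff^{n-1}(E, F)`. -/
abbrev Symb (n : ℕ) : Type u := C.Diff E F n ⧸ (C.DiffLT E F n).submoduleOf (C.Diff E F n)

/-- The projection `ζ^n : Diff^n(E, F) → Symb^n(E, F)`. -/
def zeta (n : ℕ) : C.Diff E F n →ₗ[k] C.Symb E F n :=
  ((C.DiffLT E F n).submoduleOf (C.Diff E F n)).mkQ

variable {F G}

/-- A left `A`-linear map, seen as a `k`-linear map. -/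
def resK (φ : F →ₗ[A] G) : F →ₗ[k] G where
  toFun := φ
  map_add' := map_add φ
  map_smul' c x := by
    rw [RingHom.id_apply, ← algebraMap_smul A c x, map_smul, algebraMap_smul]

/-- `Diff^n(E, φ) : Δ ↦ φ ∘ Δ`. -/
def diffMap (φ : F →ₗ[A] G) (n : ℕ) : C.Diff E F n →ₗ[k] C.Diff E G n :=
  (LinearMap.llcomp k E F G (resK φ)).restrict (by
    rintro Δ ⟨L, h⟩
    exact ⟨φ.comp L, fun e => congrArg φ (h e)⟩)

theorem diffMap_apply (φ : F →ₗ[A] G) (n : ℕ) (Δ : C.Diff E F n) (e : E) :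
    (C.diffMap E φ n Δ : E →ₗ[k] G) e = φ ((Δ : E →ₗ[k] F) e) := rfl

/-- `Symb^n(E, φ) : [Δ] ↦ [φ ∘ Δ]`. -/
def symbMap (φ : F →ₗ[A] G) (n : ℕ) : C.Symb E F n →ₗ[k] C.Symb E G n :=
  Submodule.mapQ _ _ (C.diffMap E φ n) (by
    rintro Δ hΔ
    cases n with
    | zero =>
      have h : (Δ : E →ₗ[k] F) = 0 := hΔ
      change (C.diffMap E φ 0 Δ : E →ₗ[k] G) = 0
      ext e
      rw [diffMap_apply, h]; simp
    | succ n =>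
      obtain ⟨L, h⟩ := hΔ
      exact ⟨φ.comp L, fun e => congrArg φ (h e)⟩)

/-- A natural `n`-quantization for `E`: a natural section of `ζ^n : Diff^n(E, -) → Symb^n(E, -)`. -/
structure NaturalQuantization (n : ℕ) where
  app : ∀ (F : Type u) [AddCommGroup F] [Module A F] [Module k F] [IsScalarTower k A F],
    C.Symb E F n →ₗ[k] C.Diff E F n
  zeta_app : ∀ (F : Type u) [AddCommGroup F] [Module A F] [Module k F] [IsScalarTower k A F]
    (τ : C.Symb E F n), C.zeta E F n (app F τ) = τ
  naturality : ∀ (F G : Type u) [AddCommGroup F] [Module A F] [Module k F] [IsScalarTower k A F]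
    [AddCommGroup G] [Module A G] [Module k G] [IsScalarTower k A G] (φ : F →ₗ[A] G)
    (τ : C.Symb E F n), app G (C.symbMap E φ n τ) = C.diffMap E φ n (app F τ)

/-- A natural full quantization for `E`, given by a natural `n`-quantization for every `n`. -/
structure NaturalFullQuantization where
  component : ∀ n : ℕ, C.NaturalQuantization E n

/-- The map `q_F = ∑ q_F^n : ⨁ Symb^n(E, F) → Diff(E, F)`. -/
def NaturalFullQuantization.toLinearMap {C : ExteriorCalculus k A Ω} {E : Type u} [AddCommGroup E]
    [Module A E] [Module k E] (q : C.NaturalFullQuantization E)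
    (F : Type u) [AddCommGroup F] [Module A F] [Module k F] [IsScalarTower k A F] :
    (⨁ n : ℕ, C.Symb E F n) →ₗ[k] C.DiffAll E F :=
  DirectSum.toModule k ℕ (C.DiffAll E F)
    (fun n => (Submodule.inclusion (le_iSup (C.Diff E F) n)).comp ((q.component n).app F))

variable {E}

/-- `q` maps the symbol of every operator `Δ = L ∘ j^n`, with `L` left `A`-linear on `J^n E`, to
`L ∘ ι^n ∘ s^{n-1} ∘ ∇^{S^{n-1} E} ∘ ⋯ ∘ s^0 ∘ ∇^E`; here `L ∘ ι^n` is the restriction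
symbol of `Δ`. -/
def IsInducedQuantization
    (s : ∀ n : ℕ, C.FormT (C.Sym E n) 1 →ₗ[A] C.Sym E (n + 1))
    (N : ∀ n : ℕ, C.LeftConnection (C.Sym E n)) (q : C.NaturalFullQuantization E) : Prop :=
  ∀ (n : ℕ) (F : Type u) [AddCommGroup F] [Module A F] [Module k F] [IsScalarTower k A F]
    (Δ : C.Diff E F n) (L : C.Jet E n →ₗ[A] F), (∀ e, (Δ : E →ₗ[k] F) e = L (C.jJet E n e)) →
    ∀ e, (q.toLinearMap F (DirectSum.lof k ℕ (fun n => C.Symb E F n) n (C.zeta E F n Δ)) :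
      E →ₗ[k] F) e = L (C.iotaJet E n (C.iterNabla s N n e))

end Quantization

/-! ### Families of bimodule retractions -/

section Retractions

/-- `s^n : Ω^1 S^n A → S^{n+1} A` is right `A`-linear for all `n`; the right action of `a` on `S^n A`
is `S^n` of the left linear map `b ↦ b a`. -/
def IsRightLinear (s : ∀ n : ℕ, C.FormT (C.Sym A n) 1 →ₗ[A] C.Sym A (n + 1)) : Prop :=
  ∀ (n : ℕ) (a : A) (x : C.FormT (C.Sym A n) 1),
    s n (C.Om1 (C.symMap (LinearMap.toSpanSingleton A A a) n) x) =
      C.symMap (LinearMap.toSpanSingleton A A a) (n + 1) (s n x)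

variable (E : Type u) [AddCommGroup E] [Module A E]

/-- The canonical maps `S^n A ⊗_A E → S^n E` are surjective for all `n`. -/
def SymGenerated : Prop :=
  ∀ n : ℕ, ⨆ e : E, LinearMap.range (C.symMap (LinearMap.toSpanSingleton A E e) n) = ⊤

variable {E}

/-- `t^n : Ω^1 S^n E → S^{n+1} E` is the map `s^n ⊗_A id_E`, for all `n`. -/
def IsTensor (s : ∀ n : ℕ, C.FormT (C.Sym A n) 1 →ₗ[A] C.Sym A (n + 1))
    (t : ∀ n : ℕ, C.FormT (C.Sym E n) 1 →ₗ[A] C.Sym E (n + 1)) : Prop :=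
  ∀ (n : ℕ) (e : E) (x : C.FormT (C.Sym A n) 1),
    t n (C.Om1 (C.symMap (LinearMap.toSpanSingleton A E e) n) x) =
      C.symMap (LinearMap.toSpanSingleton A E e) (n + 1) (s n x)

end Retractions

end ExteriorCalculus

end NCJet

end

/-! The central object is a left linear retraction `S_n : J^n E → S^n E` of `ι^n`. A left connection
on a module `M` is the same as a left linear map `J^1 M → Ω^1 M` splitting `ι^1` (`jetLift`,
`jetLift_iota1`). Applying `J^1` to `S_n`, then the splitting given by the connection on `S^n E`,
then the retraction of `ι_∧^{n+1}`, and restricting along `l : J^{n+1} E → J^1 J^n E`, gives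
`S_{n+1}`. By induction `S_n ∘ ι^n = id` (`jetSplit_iotaJet`) and `S_n ∘ j^n` is the iterated
operator `∇^n` (`jetSplit_jJet`).

When the jets are elemental, an operator `L ∘ j^n` determines `L`, so `L ∘ j^n ↦ L ∘ ι^n ∘ S_n ∘
j^n` is a well-defined map on operators. Right exactness says that an operator of order at most `n`
has order below `n` exactly when `L ∘ ι^n = 0`. Hence this map kills lower order operators
(`Elemental.precomp_eq_zero`) and changes an operator only by one of lower order
(`RightExact.mem_DiffLT`): it descends to symbols and is a section there. Naturality holds because
`S_n` acts on the source, independently of the target.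

For the second part, a right linear retraction makes `S^{n+1} A` a bimodule direct summand of `Ω^1
S^n A`. Direct summands survive tensoring with `E`, so surjectivity of `S^n A ⊗_A E → S^n E`
improves inductively to an isomorphism (`symIsTensor`). Then `Ω^1 S^n E` is `Ω^1 S^n A ⊗_A E`, on
which `s^n ⊗ id_E` makes sense, and its identities are checked on the images of the maps `S^n(e)`.
-/

noncomputable section

namespace NCJet

namespace ExteriorCalculus

variable {k : Type w} {A Ω : Type u} [CommRing k] [Ring A] [Algebra k A] [Ring Ω] [Algebra k Ω]
  (C : ExteriorCalculus k A Ω)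

/-! ### Connections as linear maps on jets -/

section Connections

variable {C} {E : Type u} [AddCommGroup E] [Module A E]

namespace LeftConnection

variable (N : C.LeftConnection E)

/-- By the Leibniz rule `a ∇(b e) = a b ∇e + a db ⊗ e`. The two terms involve exactly the two sums
whose vanishing defines `N_d`, which is why `∇` extends to `J^1 E`. -/
theorem extend_nabla (e : E) (x : A ⊗[ℤ] A) :
    extend (A := A) (N.nabla.comp (LinearMap.toSpanSingleton A E e).toAddMonoidHom) x =
      mulA x • N.nabla e + BT.tmul A (C.symA x) e := by
  induction x using TensorProduct.induction_on with
  | zero => simp [BT.zero_tmul]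
  | tmul a b =>
    change a • N.nabla (b • e) = (a * b) • N.nabla e + BT.tmul A (a • C.dA b) e
    rw [N.leibniz, smul_add, mul_smul, BT.smul_tmul']
  | add x y hx hy =>
    rw [map_add, hx, hy, map_add, map_add, add_smul, BT.add_tmul, add_add_add_comm]

/-- The left linear map `J^1 E → Ω^1 E`, `[a ⊗ e] ↦ a ∇ e`, through which `∇` factors. -/
def jetLift : C.J1 E →ₗ[A] C.FormT E 1 :=
  C.J1lift N.nabla (fun e x hx => by
    rw [extend_nabla, show mulA x = 0 from hx.1, show C.symA x = 0 from hx.2, zero_smul,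
      BT.zero_tmul, add_zero])

@[simp] theorem jetLift_j1 (e : E) : N.jetLift (C.j1 E e) = N.nabla e := by simp [jetLift]

/-- The Leibniz rule read backwards: `a ∇(b e) - a b ∇e = a db ⊗ e`. A connection therefore splits
the 1-jet sequence. -/
theorem jetLift_iota1 (z : C.FormT E 1) : N.jetLift (C.iota1 E z) = z := by
  induction z using C.FormT_induction with
  | h0 => simp
  | ht a b e =>
    rw [iota1_tmul, map_sub, N.jetLift.map_smul, N.jetLift.map_smul, jetLift_j1, jetLift_j1, N.leibniz, smul_add,
      mul_smul, BT.smul_tmul', add_sub_cancel_left]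
  | ha x y hx hy => rw [map_add, map_add, hx, hy]

end LeftConnection

/-- The tensor product connection was built only as an additive map; this makes it a left
connection. The derivation term comes from `∇` on `Ω^1` alone, since `σ ⊗ id` is left linear. -/
theorem BimoduleConnection.tensorConn_smul (D : C.BimoduleConnection) (N : C.LeftConnection E)
    (a : A) (z : C.FormT E 1) :
    D.tensorConn N (a • z) = a • D.tensorConn N z + BT.tmul A (C.dA a) z := by
  induction z using BT.induction with
  | h0 => rw [smul_zero, map_zero, smul_zero, ← BT.mk_apply, map_zero]; simp
  | ht ω f =>
    rw [BT.smul_tmul', tensorConn_tmul, tensorConn_tmul, D.leibniz, map_add, map_smul,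
      ← BT.smul_tmul', map_smul, BT.map_tmul, BT.mk_apply, smul_add]
    abel
  | ha x y hx hy => rw [smul_add, map_add, hx, hy, map_add, smul_add, BT.tmul_add]; abel

/-- The left connection `Ω^1(s) ∘ ∇^{Ω^1 E} ∘ i` on `Q`, for a linear map `i : Q → Ω^1 E` with a
linear retraction `s`. -/
def inducedConnection (D : C.BimoduleConnection) {Q : Type u} [AddCommGroup Q] [Module A Q]
    (i : Q →ₗ[A] C.FormT E 1) (s : C.FormT E 1 →ₗ[A] Q) (h : ∀ x, s (i x) = x)
    (N : C.LeftConnection E) : C.LeftConnection Q where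
  nabla := (C.Om1 s).toAddMonoidHom.comp ((D.tensorConn N).comp i.toAddMonoidHom)
  leibniz a x := by
    change C.Om1 s (D.tensorConn N (i (a • x))) = a • C.Om1 s (D.tensorConn N (i x)) + _
    -- The derivation term becomes `da ⊗ s(i x)`, and the retraction identity turns it into `da ⊗
    -- x`.
    rw [map_smul, D.tensorConn_smul, map_add, map_smul, BT.map_tmul, h]

/-- The connections on all `S^n E` built from a connection on `E` and retractions. -/
def symConnection (D : C.BimoduleConnection) (N₀ : C.LeftConnection E)
    (t : ∀ n : ℕ, C.FormT (C.Sym E n) 1 →ₗ[A] C.Sym E (n + 1)) (ht : C.IsRetraction E t) :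
    ∀ n : ℕ, C.LeftConnection (C.Sym E n)
  | 0 => N₀
  | n + 1 => inducedConnection D (C.iotaW E n) (t n) (ht n) (symConnection D N₀ t ht n)

theorem symConnection_induced (D : C.BimoduleConnection) (N₀ : C.LeftConnection E)
    (t : ∀ n : ℕ, C.FormT (C.Sym E n) 1 →ₗ[A] C.Sym E (n + 1)) (ht : C.IsRetraction E t) :
    C.IsInducedConnection D N₀ t (symConnection D N₀ t ht) :=
  ⟨rfl, fun _ _ => rfl⟩

end Connections

/-! ### The splitting of the jet sequences -/

section Splitting

variable {C} {E : Type u} [AddCommGroup E] [Module A E]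
  (t : ∀ n : ℕ, C.FormT (C.Sym E n) 1 →ₗ[A] C.Sym E (n + 1))
  (N : ∀ n : ℕ, C.LeftConnection (C.Sym E n))

/-- The left linear map `J^n E → S^n E` through which the operator `iterNabla` factors. -/
def jetSplit : (n : ℕ) → C.Jet E n →ₗ[A] C.Sym E n
  | 0 => (LinearMap.id : E →ₗ[A] E)
  | n + 1 => (t n).comp ((N n).jetLift.comp ((C.J1map (jetSplit n)).comp (C.lJet E n)))

theorem jetSplit_succ (n : ℕ) (x : C.Jet E (n + 1)) :
    jetSplit t N (n + 1) x = t n ((N n).jetLift (C.J1map (jetSplit t N n) (C.lJet E n x))) := rfl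

/-- Since `l ∘ j^{n+1} = j^1 ∘ j^n`, each stage of the splitting evaluates one more connection on
the previous result. -/
theorem jetSplit_jJet (n : ℕ) (e : E) : jetSplit t N n (C.jJet E n e) = C.iterNabla t N n e := by
  induction n with
  | zero => rfl
  | succ n ih => rw [jetSplit_succ, lJet_jJet, J1map_j1, ih, LeftConnection.jetLift_j1]; rfl

theorem Om1_id {F : Type u} [AddCommGroup F] [Module A F] (z : C.FormT F 1) :
    C.Om1 (LinearMap.id : F →ₗ[A] F) z = z := by
  induction z using BT.induction with
  | h0 => simp
  | ht x y => simp
  | ha x y hx hy => rw [map_add, hx, hy]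

variable {t} in
-- The inclusion `l ∘ ι^{n+1} = ι^1 ∘ Ω^1(ι^n) ∘ ι_∧` is undone factor by factor: naturality of
-- `ι^1` moves the inductive splitting onto `Ω^1(ι^n)`, the connection cancels `ι^1`, and `t`
-- cancels `ι_∧`.
theorem jetSplit_iotaJet (ht : C.IsRetraction E t) (n : ℕ) (x : C.Sym E n) :
    jetSplit t N n (C.iotaJet E n x) = x := by
  induction n with
  | zero => rfl
  | succ n ih =>
    have h : (jetSplit t N n).comp (C.iotaJet E n) = LinearMap.id := LinearMap.ext ih
    rw [jetSplit_succ, lJet_iotaJet, J1map_iota1, Om1_comp, h, Om1_id,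
      LeftConnection.jetLift_iota1, ht]

end Splitting

/-! ### Natural quantizations -/

section Quantization

variable {E : Type u} [AddCommGroup E] [Module A E]

theorem dA_algebraMap (c : k) : C.dA (algebraMap k A c) = 0 := by
  have h1 : C.d 1 = 0 := by simpa using congrArg Form.val C.dA_one
  ext
  simp [Algebra.algebraMap_eq_smul_one, h1]

/-- The difference of the two sides is `ι^1(dc ⊗ e)`, and `dc = 0` for scalars `c`. Jets are formed
from tensor products over `ℤ`, so compatibility with `k` has to be derived. -/
theorem j1_algebraMap_smul (c : k) (e : E) :
    C.j1 E (algebraMap k A c • e) = algebraMap k A c • C.j1 E e := by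
  have h := C.iota1_tmul 1 (algebraMap k A c) e
  rw [dA_algebraMap, smul_zero, BT.zero_tmul, map_zero, one_smul, one_mul] at h
  exact (sub_eq_zero.1 h.symm)

theorem jJet_algebraMap_smul (n : ℕ) (c : k) (e : E) :
    C.jJet E n (algebraMap k A c • e) = algebraMap k A c • C.jJet E n e := by
  induction n with
  | zero => rfl
  | succ n ih =>
    apply C.lJet_injective E n
    rw [lJet_jJet, ih, (C.lJet E n).map_smul, lJet_jJet, j1_algebraMap_smul]

theorem piJet_jJet (n : ℕ) (e : E) : C.piJet E n (C.jJet E (n + 1) e) = C.jJet E n e := by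
  change C.p1 _ (C.lJet E n _) = _
  rw [lJet_jJet, p1_j1]

variable {C} in
-- Lifts of operators to jets are unique: this is what makes the symbol `L ∘ ι^n` depend only on the
-- operator.
theorem Elemental.ext (h : C.Elemental E) {n : ℕ} {F : Type u} [AddCommGroup F] [Module A F]
    {L L' : C.Jet E n →ₗ[A] F} (hL : ∀ e, L (C.jJet E n e) = L' (C.jJet E n e)) : L = L' := by
  refine LinearMap.ext_on (h n) ?_
  rintro _ ⟨e, rfl⟩
  exact hL e

variable [Module k E] [IsScalarTower k A E]

/-! ### Operators of order `n` as linear maps on `J^n E` -/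

section Operators

variable {F : Type u} [AddCommGroup F] [Module A F] [Module k F] [IsScalarTower k A F]

/-- The differential operator `L ∘ j^n`. -/
def ofJet (n : ℕ) (L : C.Jet E n →ₗ[A] F) : C.Diff E F n :=
  ⟨{ toFun := fun e => L (C.jJet E n e)
     map_add' := fun e e' => by rw [map_add, map_add]
     map_smul' := fun c e => by
      rw [← algebraMap_smul A c e, jJet_algebraMap_smul, map_smul, algebraMap_smul,
        RingHom.id_apply] }, L, fun _ => rfl⟩

variable {C}

omit [IsScalarTower k A E] in
theorem Elemental.apply_eq (hel : C.Elemental E) {n : ℕ} {Δ : C.Diff E F n}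
    {L L' : C.Jet E n →ₗ[A] F} (hL : ∀ e, (Δ : E →ₗ[k] F) e = L (C.jJet E n e))
    (hL' : ∀ e, (Δ : E →ₗ[k] F) e = L' (C.jJet E n e)) : L = L' :=
  hel.ext fun e => (hL e).symm.trans (hL' e)

/-- `Δ = L ∘ j^n ↦ L ∘ P ∘ j^n`, for an endomorphism `P` of `J^n E`. -/
def Elemental.precomp (hel : C.Elemental E) (F : Type u) [AddCommGroup F] [Module A F] [Module k F]
    [IsScalarTower k A F] {n : ℕ} (P : C.Jet E n →ₗ[A] C.Jet E n) :
    C.Diff E F n →ₗ[k] C.Diff E F n where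
  toFun Δ := C.ofJet n ((Classical.choose Δ.2).comp P)
  map_add' Δ Δ' := by
    -- The chosen lifts add up because lifts are unique.
    have h : Classical.choose (Δ + Δ').2 = Classical.choose Δ.2 + Classical.choose Δ'.2 :=
      hel.apply_eq (Δ := Δ + Δ') (Classical.choose_spec (Δ + Δ').2) fun e =>
        congrArg₂ (· + ·) (Classical.choose_spec Δ.2 e) (Classical.choose_spec Δ'.2 e)
    rw [h]; rfl
  map_smul' c Δ := by
    have h : Classical.choose (c • Δ).2 = c • Classical.choose Δ.2 :=
      hel.apply_eq (Δ := c • Δ) (Classical.choose_spec (c • Δ).2) fun e =>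
        congrArg (c • ·) (Classical.choose_spec Δ.2 e)
    rw [h]; rfl

theorem Elemental.precomp_apply (hel : C.Elemental E) {n : ℕ} (P : C.Jet E n →ₗ[A] C.Jet E n)
    {Δ : C.Diff E F n} {L : C.Jet E n →ₗ[A] F}
    (hL : ∀ e, (Δ : E →ₗ[k] F) e = L (C.jJet E n e)) (e : E) :
    (hel.precomp F P Δ : E →ₗ[k] F) e = L (P (C.jJet E n e)) := by
  rw [hel.apply_eq hL (Classical.choose_spec Δ.2)]; rfl

/-- `L ∘ j^n ↦ L ∘ ι^n ∘ S ∘ j^n` vanishes on the operators of order less than `n`. -/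
theorem Elemental.precomp_eq_zero (hel : C.Elemental E)
    (hex : C.RightExact E) (n : ℕ) (S : C.Jet E n →ₗ[A] C.Sym E n) (Δ : C.Diff E F n)
    (hΔ : (Δ : E →ₗ[k] F) ∈ C.DiffLT E F n) :
    hel.precomp F ((C.iotaJet E n).comp S) Δ = 0 := by
  apply Subtype.ext
  apply LinearMap.ext
  intro e
  cases n with
  | zero =>
    have h : (Δ : E →ₗ[k] F) = 0 := hΔ
    exact hel.precomp_apply _ (L := 0) (fun e => by rw [h]; rfl) e
  | succ n =>
    obtain ⟨L, hL⟩ := hΔ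
    -- As an operator of order `n + 1`, `L ∘ j^n` has the lift `L ∘ π`, because `π ∘ j^{n+1} = j^n`;
    -- then `π ∘ ι^{n+1} = 0` finishes.
    refine (hel.precomp_apply _ (L := L.comp (C.piJet E n)) (fun e => ?_) e).trans ?_
    · rw [hL, LinearMap.comp_apply, piJet_jJet]
    · rw [LinearMap.comp_apply, LinearMap.comp_apply, (hex n).1.apply_apply_eq_zero, map_zero]; rfl

omit [IsScalarTower k A E] in
/-- An operator `L ∘ j^n` with `L ∘ ι^n = 0` has order less than `n`. -/
theorem RightExact.mem_DiffLT (hex : C.RightExact E) (n : ℕ) (Δ : E →ₗ[k] F)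
    (L : C.Jet E n →ₗ[A] F) (hL : ∀ e, Δ e = L (C.jJet E n e))
    (h : ∀ x, L (C.iotaJet E n x) = 0) : Δ ∈ C.DiffLT E F n := by
  cases n with
  | zero =>
    change Δ = 0
    ext e
    -- In order zero both `ι^0` and `j^0` are the identity of `E`.
    exact (hL e).trans (h e)
  | succ n =>
    have hk : LinearMap.ker (C.piJet E n) ≤ LinearMap.ker L := by
      intro x hx
      obtain ⟨y, rfl⟩ := ((hex n).1 x).1 hx
      exact h y
    -- The lift to `J^n E` is `L` descended to `J^{n+1} E / ker π`, which surjectivity of `π`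
    -- identifies with `J^n E`.
    refine ⟨((LinearMap.ker (C.piJet E n)).liftQ L hk).comp
      ((C.piJet E n).quotKerEquivOfSurjective (hex n).2).symm.toLinearMap, fun e => ?_⟩
    have : ((C.piJet E n).quotKerEquivOfSurjective (hex n).2).symm (C.jJet E n e) =
        (LinearMap.ker (C.piJet E n)).mkQ (C.jJet E (n + 1) e) := by
      rw [LinearEquiv.symm_apply_eq, ← piJet_jJet]; rfl
    rw [LinearMap.comp_apply, LinearEquiv.coe_coe, this, hL]; rfl

end Operators

variable {C}

/-- The natural `n`-quantization `[L ∘ j^n] ↦ L ∘ ι^n ∘ S ∘ j^n` given by a linear retraction `S`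
of `ι^n`. -/
def splitQuantization (hel : C.Elemental E) (hex : C.RightExact E) (n : ℕ)
    (S : C.Jet E n →ₗ[A] C.Sym E n) (hS : ∀ x, S (C.iotaJet E n x) = x) :
    C.NaturalQuantization E n where
  app F _ _ _ _ := Submodule.liftQ _ (hel.precomp F ((C.iotaJet E n).comp S))
    (fun Δ hΔ => hel.precomp_eq_zero hex n S Δ hΔ)
  zeta_app F _ _ _ _ τ := by
    obtain ⟨Δ, rfl⟩ := Submodule.mkQ_surjective _ τ
    obtain ⟨L, hL⟩ := Δ.2
    -- The correction `L ∘ ι^n ∘ S - L` vanishes on the image of `ι^n`, since `S ∘ ι^n = id`; so it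
    -- has lower order.
    refine (Submodule.Quotient.eq _).2
      (hex.mem_DiffLT n _ (L.comp ((C.iotaJet E n).comp S) - L) (fun e => ?_) fun x => ?_)
    · exact congrArg₂ (· - ·) (hel.precomp_apply ((C.iotaJet E n).comp S) hL e) (hL e)
    · simp [hS]
  naturality F G _ _ _ _ _ _ _ _ φ τ := by
    obtain ⟨Δ, rfl⟩ := Submodule.mkQ_surjective _ τ
    obtain ⟨L, hL⟩ := Δ.2
    apply Subtype.ext
    apply LinearMap.ext
    intro e
    refine (hel.precomp_apply (Δ := C.diffMap E φ n Δ) ((C.iotaJet E n).comp S) (L := φ.comp L)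
      (fun e => congrArg φ (hL e)) e).trans ?_
    exact congrArg φ (hel.precomp_apply ((C.iotaJet E n).comp S) hL e).symm

omit [IsScalarTower k A E] in
theorem NaturalFullQuantization.toLinearMap_lof (q : C.NaturalFullQuantization E)
    (F : Type u) [AddCommGroup F] [Module A F] [Module k F] [IsScalarTower k A F] (n : ℕ)
    (τ : C.Symb E F n) :
    q.toLinearMap F (DirectSum.lof k ℕ (fun n => C.Symb E F n) n τ) =
      Submodule.inclusion (le_iSup (C.Diff E F) n) ((q.component n).app F τ) :=
  DirectSum.toModule_lof k n τ

/-- The retraction of `ι^n` to use is `jetSplit`, whose composite with `j^n` is the iterated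
operator. Any family of connections on the modules `S^n E` will do. -/
theorem exists_inducedQuantization (hel : C.Elemental E) (hex : C.RightExact E)
    (t : ∀ n : ℕ, C.FormT (C.Sym E n) 1 →ₗ[A] C.Sym E (n + 1)) (ht : C.IsRetraction E t)
    (N : ∀ n : ℕ, C.LeftConnection (C.Sym E n)) :
    ∃ q : C.NaturalFullQuantization E, C.IsInducedQuantization t N q := by
  refine ⟨⟨fun n => splitQuantization hel hex n (jetSplit t N n) (jetSplit_iotaJet N ht n)⟩, ?_⟩
  intro n F _ _ _ _ Δ L hL e
  rw [NaturalFullQuantization.toLinearMap_lof, ← jetSplit_jJet]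
  exact hel.precomp_apply ((C.iotaJet E n).comp (jetSplit t N n)) hL e

end Quantization

/-! ### Tensoring bimodule retractions with a module -/

section Retractions

section Functoriality

variable {C} {E F G : Type u} [AddCommGroup E] [Module A E] [AddCommGroup F] [Module A F]
  [AddCommGroup G] [Module A G]

theorem symMap_comp (g : F →ₗ[A] G) (f : E →ₗ[A] F) (n : ℕ) :
    C.symMap (g.comp f) n = (C.symMap g n).comp (C.symMap f n) := by
  induction n with
  | zero => rfl
  | succ n ih =>
    ext x
    apply C.iotaW_injective G n
    rw [iotaW_symMap, ih, LinearMap.comp_apply, iotaW_symMap, iotaW_symMap, Om1_comp]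

theorem symMap_add (f g : E →ₗ[A] F) (n : ℕ) :
    C.symMap (f + g) n = C.symMap f n + C.symMap g n := by
  induction n with
  | zero => rfl
  | succ n ih =>
    ext x
    apply C.iotaW_injective F n
    rw [iotaW_symMap, ih, LinearMap.add_apply, map_add, iotaW_symMap, iotaW_symMap, Om1_add]

end Functoriality

variable {C} {E : Type u} [AddCommGroup E] [Module A E]

/-- `S^n(e) : S^n A → S^n E`, induced by `a ↦ a e`. -/
abbrev symAct (C : ExteriorCalculus k A Ω) (n : ℕ) (e : E) : C.Sym A n →ₗ[A] C.Sym E n :=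
  C.symMap (LinearMap.toSpanSingleton A E e) n

theorem symAct_add (n : ℕ) (e e' : E) : C.symAct n (e + e') = C.symAct n e + C.symAct n e' := by
  rw [← symMap_add]
  exact congrArg (C.symMap · n) (LinearMap.ext fun a => smul_add a e e')

/-- As `S^n(a)` is right multiplication by `a` on `S^n A`, this is the balancing condition of the
pairing `S^n A × E → S^n E`. -/
theorem symAct_smul (n : ℕ) (a : A) (e : E) :
    C.symAct n (a • e) = (C.symAct n e).comp (C.symAct n a) := by
  rw [← symMap_comp]
  exact congrArg (C.symMap · n) (LinearMap.ext fun b => (mul_smul b a e).symm)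

/-- Two additive maps on `S^n E` which agree on the images of all `S^n(e)` are equal. -/
theorem SymGenerated.addHom_ext (h : C.SymGenerated E) {n : ℕ} {G : Type*} [AddCommGroup G]
    {f g : C.Sym E n →+ G} (hfg : ∀ e y, f (C.symAct n e y) = g (C.symAct n e y)) : f = g := by
  ext z
  have hz : z ∈ ⨆ e : E, LinearMap.range (C.symAct n e) := by rw [h n]; trivial
  refine Submodule.iSup_induction (fun e : E => LinearMap.range (C.symAct n e))
    (motive := fun z => f z = g z) hz ?_ (by rw [map_zero, map_zero])
    (fun x y hx hy => by rw [map_add, map_add, hx, hy])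
  rintro e _ ⟨y, rfl⟩
  exact hfg e y

/-- The same for additive maps on `Ω^1 S^n E`. -/
theorem SymGenerated.addHom_ext_form (h : C.SymGenerated E) {n : ℕ} {G : Type*} [AddCommGroup G]
    {f g : C.FormT (C.Sym E n) 1 →+ G}
    (hfg : ∀ e x, f (C.Om1 (C.symAct n e) x) = g (C.Om1 (C.symAct n e) x)) : f = g := by
  ext z
  induction z using BT.induction with
  | h0 => rw [map_zero, map_zero]
  | ht ω z =>
    have := h.addHom_ext (n := n)
      (f := f.comp (AddMonoidHom.mk' (fun z => BT.tmul A ω z) (BT.tmul_add ω)))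
      (g := g.comp (AddMonoidHom.mk' (fun z => BT.tmul A ω z) (BT.tmul_add ω)))
      (fun e y => hfg e (BT.tmul A ω y))
    exact DFunLike.congr_fun this z
  | ha x y hx hy => rw [map_add, map_add, hx, hy]

/-! ### Universal property of `S^n E` as a tensor product -/

variable (C E) in
/-- `S^n E` has the universal property of the tensor product `S^n A ⊗_A E`. -/
def SymIsTensor (n : ℕ) : Prop :=
  ∀ (G : Type u) [AddCommGroup G] (f : C.Sym A n →+ E →+ G),
    (∀ y (a : A) (e : E), f (C.symAct n a y) e = f y (a • e)) →
    ∃ g : C.Sym E n →+ G, ∀ e y, g (C.symAct n e y) = f y e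

theorem symIsTensor_zero : C.SymIsTensor E 0 := by
  intro G _ f hf
  refine ⟨(f (1 : A) : E →+ G), fun e y => ?_⟩
  have h : C.symAct 0 (y : A) (1 : A) = y := one_mul (M := A) y
  exact (hf (1 : A) y e).symm.trans (congrArg (fun z => f z e) h)

/-- If `S^n E` is `S^n A ⊗_A E`, then `Ω^1 S^n E` is `Ω^1 S^n A ⊗_A E`. -/
theorem SymIsTensor.form (hgen : C.SymGenerated E) {n : ℕ} (h : C.SymIsTensor E n)
    (G : Type u) [AddCommGroup G] (f : C.FormT (C.Sym A n) 1 →+ E →+ G)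
    (hf : ∀ x (a : A) (e : E), f (C.Om1 (C.symAct n a) x) e = f x (a • e)) :
    ∃ g : C.FormT (C.Sym E n) 1 →+ G, ∀ e x, g (C.Om1 (C.symAct n e) x) = f x e := by
  -- For fixed `ω`, the balanced map `(y, e) ↦ f(ω ⊗ y, e)` extends to `S^n E`. Additivity and
  -- balancedness in `ω` then follow from uniqueness of such extensions.
  choose g hg using fun ω : C.Form 1 => h G
    (f.comp (AddMonoidHom.mk' (fun y => BT.tmul A ω y) (BT.tmul_add ω)))
    (fun y a e => hf (BT.tmul A ω y) a e)
  have hg' : ∀ ω e y, g ω (C.symAct n e y) = f (BT.tmul A ω y) e := hg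
  let g' : C.Form 1 →+ C.Sym E n →+ G := AddMonoidHom.mk' g (fun ω ω' =>
    hgen.addHom_ext fun e y => by
      rw [AddMonoidHom.add_apply, hg', hg', hg', BT.add_tmul, map_add, AddMonoidHom.add_apply])
  refine ⟨BT.liftAdd (A := A) g' fun ω a z => ?_, fun e x => ?_⟩
  · have := hgen.addHom_ext (f := g (MulOpposite.op a • ω))
      (g := (g ω).comp (DistribSMul.toAddMonoidHom (C.Sym E n) a)) (fun e y => by
        rw [hg', AddMonoidHom.comp_apply, DistribSMul.toAddMonoidHom_apply, ← map_smul, hg',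
          BT.tmul_smul])
    exact DFunLike.congr_fun this z
  · induction x using BT.induction with
    | h0 => simp
    | ht ω y => exact hg' ω e y
    | ha x y hx hy => rw [map_add, map_add, map_add, hx, hy, AddMonoidHom.add_apply]

/-- `(y, e) ↦ S^n(e)(y)`. -/
def symPairing (C : ExteriorCalculus k A Ω) (E : Type u) [AddCommGroup E] [Module A E] (n : ℕ) :
    C.Sym A n →+ E →+ C.Sym E n :=
  AddMonoidHom.mk' (fun y => AddMonoidHom.mk' (fun e => C.symAct n e y)
    (fun e e' => by rw [symAct_add, LinearMap.add_apply])) (fun y y' => by ext e; simp)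

variable {s : ∀ n : ℕ, C.FormT (C.Sym A n) 1 →ₗ[A] C.Sym A (n + 1)}

/-- A balanced map on `S^{n+1} A × E` is pulled back along `s^n`, staying balanced by right
linearity, extended to `Ω^1 S^n E`, and restricted along `ι_∧`. Since `s^n ∘ ι_∧ = id`, the original
map is recovered. -/
theorem symIsTensor (hs : C.IsRetraction A s) (hr : C.IsRightLinear s) (hgen : C.SymGenerated E)
    (n : ℕ) : C.SymIsTensor E n := by
  induction n with
  | zero => exact symIsTensor_zero
  | succ n ih =>
    intro G _ f hf
    obtain ⟨g, hg⟩ := ih.form hgen G (f.comp (s n).toAddMonoidHom) (fun x a e => by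
      change f (s n _) e = f (s n x) _
      rw [hr, hf])
    refine ⟨g.comp (C.iotaW E n).toAddMonoidHom, fun e y => ?_⟩
    change g (C.iotaW E n _) = _
    rw [iotaW_symMap, hg]
    change f (s n _) e = _
    rw [hs]

/-- The pairing `(x, e) ↦ S^{n+1}(e)(s^n x)` is balanced by right linearity of `s^n`, so it extends
to `Ω^1 S^n E`; left linearity of `s^n` passes to the extension. -/
theorem exists_isTensor (hs : C.IsRetraction A s) (hr : C.IsRightLinear s)
    (hgen : C.SymGenerated E) :
    ∃ t : ∀ n : ℕ, C.FormT (C.Sym E n) 1 →ₗ[A] C.Sym E (n + 1), C.IsTensor s t := by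
  choose g hg using fun n => (symIsTensor hs hr hgen n).form hgen (C.Sym E (n + 1))
    ((C.symPairing E (n + 1)).comp (s n).toAddMonoidHom) (fun x a e => by
      change C.symAct (n + 1) e (s n _) = C.symAct (n + 1) (a • e) (s n x)
      rw [hr, symAct_smul]; rfl)
  have hg' : ∀ n e x, g n (C.Om1 (C.symAct n e) x) = C.symAct (n + 1) e (s n x) := hg
  refine ⟨fun n => { g n with
    map_smul' := fun a z => ?_ }, fun n e x => hg' n e x⟩
  have := hgen.addHom_ext_form (f := (g n).comp (DistribSMul.toAddMonoidHom _ a))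
    (g := (DistribSMul.toAddMonoidHom _ a).comp (g n)) (fun e x => by
      simp only [AddMonoidHom.comp_apply, DistribSMul.toAddMonoidHom_apply]
      rw [← map_smul, hg', hg', map_smul, map_smul])
  exact DFunLike.congr_fun this z

theorem IsTensor.unique (hgen : C.SymGenerated E)
    {t t' : ∀ n : ℕ, C.FormT (C.Sym E n) 1 →ₗ[A] C.Sym E (n + 1)} (ht : C.IsTensor s t)
    (ht' : C.IsTensor s t') : t' = t := by
  funext n
  apply LinearMap.toAddMonoidHom_injective
  exact hgen.addHom_ext_form fun e x => (ht' n e x).trans (ht n e x).symm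

/-- On the image of `S^{n+1}(e)`, naturality of `ι_∧` reduces the claim to `s^n ∘ ι_∧ = id` over
`A`; these images generate. -/
theorem IsTensor.isRetraction (hs : C.IsRetraction A s) (hgen : C.SymGenerated E)
    {t : ∀ n : ℕ, C.FormT (C.Sym E n) 1 →ₗ[A] C.Sym E (n + 1)} (ht : C.IsTensor s t) :
    C.IsRetraction E t := by
  intro n
  have := hgen.addHom_ext (f := (t n).toAddMonoidHom.comp (C.iotaW E n).toAddMonoidHom)
    (g := AddMonoidHom.id _) (fun e y => by
      change t n (C.iotaW E n _) = _
      rw [iotaW_symMap, ht, hs]; rfl)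
  exact DFunLike.congr_fun this

end Retractions

end ExteriorCalculus

end NCJet

end

theorem corollary5p18 {k : Type w} {A Ω : Type u} [CommRing k] [Ring A] [Algebra k A]
    [Ring Ω] [Algebra k Ω] (C : NCJet.ExteriorCalculus k A Ω)
    (E : Type u) [AddCommGroup E] [Module A E] [Module k E] [IsScalarTower k A E]
    (hel : C.Elemental E) (hex : C.RightExact E)
    (D : C.BimoduleConnection) (N₀ : C.LeftConnection E) :
    (∀ t : ∀ n : ℕ, C.FormT (C.Sym E n) 1 →ₗ[A] C.Sym E (n + 1), C.IsRetraction E t →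
      ∃ N : ∀ n : ℕ, C.LeftConnection (C.Sym E n), C.IsInducedConnection D N₀ t N ∧
        ∃ q : C.NaturalFullQuantization E, C.IsInducedQuantization t N q) ∧
    (∀ s : ∀ n : ℕ, C.FormT (C.Sym A n) 1 →ₗ[A] C.Sym A (n + 1),
      C.IsRetraction A s → C.IsRightLinear s → C.SymGenerated E →
      ∃ t : ∀ n : ℕ, C.FormT (C.Sym E n) 1 →ₗ[A] C.Sym E (n + 1),
        C.IsTensor s t ∧ (∀ t', C.IsTensor s t' → t' = t) ∧ C.IsRetraction E t ∧
        ∃ N : ∀ n : ℕ, C.LeftConnection (C.Sym E n), C.IsInducedConnection D N₀ t N ∧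
          ∃ q : C.NaturalFullQuantization E, C.IsInducedQuantization t N q) := by
  refine ⟨fun t ht => ⟨NCJet.ExteriorCalculus.symConnection D N₀ t ht,
    NCJet.ExteriorCalculus.symConnection_induced D N₀ t ht,
    NCJet.ExteriorCalculus.exists_inducedQuantization hel hex t ht _⟩, fun s hs hr hgen => ?_⟩
  obtain ⟨t, ht⟩ := NCJet.ExteriorCalculus.exists_isTensor hs hr hgen
  have hret := ht.isRetraction hs hgen
  exact ⟨t, ht, fun t' ht' => ht.unique hgen ht', hret,
    NCJet.ExteriorCalculus.symConnection D N₀ t hret,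
    NCJet.ExteriorCalculus.symConnection_induced D N₀ t hret,
    NCJet.ExteriorCalculus.exists_inducedQuantization hel hex t hret _⟩
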